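/- Graphs are finite and may have parallel edges but no loops. For a graph $H$ and $S\subseteq V(H)$, $\partial_H(S)$ is the set of edges of $H$ with precisely one end in $S$. A graph is $t$-edge-connected if it has at least two vertices and remains connected whenever fewer than $t$ edges are deleted. An $r$-graph is an $r$-regular graph $H$ with $|\partial_H(S)|\ge r$ for every $S\subseteq V(H)$ with $|S|$ odd. Let $P$ be the Petersen graph, with vertices $u_i,v_i$ ($i\in\mathbb Z_5$) and edges $v_iv_{i+1}$, $u_iu_{i+2}$, $u_iv_i$. Let $M_0=\{u_iv_i : i\in\mathbb Z_5\}$ and, for $i\in\{1,\dots,5\}$, let $M_i=\{u_iv_i,\ v_{i+1}v_{i+2},\ v_{i+3}v_{i+4},\ u_{i+1}u_{i+3},\ u_{i+2}u_{i+4}\}$ (indices modulo $5$), the only perfect matching of $P$ other than $M_0$ that contains $u_iv_i$. For $k\ge 1$ define the following graphs. - $P_k=P+kM_0+(k-1)(M_1+M_3+M_4)$ is obtained from $P$ by adding $k$ parallel copies of every edge of $M_0$ and $k-1$ parallel copies of every edge of each of $M_1,M_3,M_4$. - $Q_k$ is obtained from two disjoint copies $P_k^1,P_k^2$ of $P_k$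 by removing, for $i\in\{1,2\}$, all edges between the copies $u_1^i$ and $v_1^i$ of $u_1$ and $v_1$, and then identifying $u_1^1$ with $u_1^2$. - $T_k$ is the graph with vertices $x_i$ ($i\in\mathbb Z_3$) and exactly $k$ parallel edges between any two of them. Let $G$ be a cubic graph. A graph $S_k(G)$ is obtained from $G$ by replacing every vertex $w$ by a copy $T_k^w$ of $T_k$ and every edge $e$ by a copy $Q_k^e$ of $Q_k$ and, for every vertex $w$ and every edge $e$ incident with $w$, choosing $i\in\mathbb Z_3$ and one of the two vertices $v_1^1,v_1^2$ of $Q_k^e$ and adding $k$ edges between this vertex and the vertex $x_i$ of $T_k^w$ and $k$ edges between this vertex and the vertex $x_{i+1}$ of $T_k^w$. The choices are made so that $S_k(G)$ is $4k$-regular, i.e. the three edges at each vertex $w$ receive three different values of $i$, and the two ends of each edge $e$ receive different vertices among $v_1^1,v_1^2$. **Theorem.** Let $G$ be a connected bridgeless cubic graph with an even number of edges and let $k\ge 1$. Then $S_k(G)$ (for every admissible choice of the connections) is a $4k$-edge-connected $4k$-graph without $4k-2$ pairwise disjoint perfect matchings. -/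

import Mathlib

open scoped Graph

namespace Graph

variable {α β : Type*}

/-- `y` can be reached from `x` along edges of `G`. -/
def Reaches (G : Graph α β) (x y : α) : Prop :=
  Relation.ReflTransGen G.Adj x y

/-- `G` is nonempty and any two of its vertices are joined by a walk. -/
def IsConnected (G : Graph α β) : Prop :=
  V(G).Nonempty ∧ ∀ x ∈ V(G), ∀ y ∈ V(G), G.Reaches x y

/-- No edge of `G` is a bridge: the ends of each edge remain joined by a walk when that edge is
deleted. -/
def IsBridgeless (G : Graph α β) : Prop :=
  ∀ e x y, G.IsLink e x y → (G.deleteEdges {e}).Reaches x y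

/-- `G` has at least two vertices, and it stays connected when fewer than `t` edges are deleted. -/
def IsEdgeConnected (G : Graph α β) (t : ℕ) : Prop :=
  V(G).Nontrivial ∧ ∀ F ⊆ E(G), F.encard < t → (G.deleteEdges F).IsConnected

/-- The graph `G` is `r`-regular. It is only used for graphs without loops, where the degree of a
vertex is the number of edges that are incident with it. -/
def IsRegular (G : Graph α β) (r : ℕ) : Prop :=
  ∀ x ∈ V(G), (G.incidenceSet x).encard = r

/-- The edges of `G` with precisely one end in `S`. -/
def edgeBoundary (G : Graph α β) (S : Set α) : Set β :=
  {e | ∃ x ∈ S, ∃ y ∉ S, G.IsLink e x y}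

/-- Finite graphs; parallel edges are allowed, but no loops. -/
structure IsFiniteLoopless (G : Graph α β) : Prop where
  finite_vertexSet : V(G).Finite
  finite_edgeSet : E(G).Finite
  loopless : G.Loopless

/-- Cubic graphs: finite, loopless, `3`-regular. -/
structure IsCubic (G : Graph α β) : Prop extends G.IsFiniteLoopless where
  regular : G.IsRegular 3

/-- `r`-graphs: finite loopless `r`-regular graphs in which every odd set of vertices has at least
`r` boundary edges. -/
structure IsRGraph (G : Graph α β) (r : ℕ) : Prop extends G.IsFiniteLoopless where
  regular : G.IsRegular r
  odd_cut : ∀ S ⊆ V(G), Odd S.ncard → (r : ℕ∞) ≤ (G.edgeBoundary S).encard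

/-- The edge set of a `1`-factor of a loopless graph: every vertex is incident with exactly one
edge of `M`. -/
def IsPerfectMatching (G : Graph α β) (M : Set β) : Prop :=
  M ⊆ E(G) ∧ ∀ x ∈ V(G), ∃! e, e ∈ M ∧ G.Inc e x

/-- `G` has `n` pairwise disjoint perfect matchings. -/
def HasDisjointPerfectMatchings (G : Graph α β) (n : ℕ) : Prop :=
  ∃ N : Fin n → Set β, (∀ i, G.IsPerfectMatching (N i)) ∧ Pairwise fun i j ↦ Disjoint (N i) (N j)

/-- The graph `G + ∑ i, N i`: to `G` a parallel copy `(e, some i)` of each edge `e ∈ N i` is added,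
for every index `i`. The original edges are the pairs `(e, none)`. -/
def addCopies {ι : Type*} (G : Graph α β) (N : ι → Set β) : Graph α (β × Option ι) where
  vertexSet := V(G)
  IsLink f x y := G.IsLink f.1 x y ∧ ∀ i, f.2 = some i → f.1 ∈ N i
  isLink_symm _ _ := ⟨fun _ _ h ↦ ⟨h.1.symm, h.2⟩⟩
  eq_or_eq_of_isLink_of_isLink _ _ _ _ _ h h' := h.1.left_eq_or_eq h'.1
  left_mem_of_isLink _ _ _ h := h.1.left_mem

/-- The disjoint union of two copies of `G`; the `i`-th copy of a vertex or edge `a` is `(i, a)`. -/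
def twoCopies (G : Graph α β) : Graph (Fin 2 × α) (Fin 2 × β) where
  vertexSet := {x | x.2 ∈ V(G)}
  IsLink f x y := f.1 = x.1 ∧ f.1 = y.1 ∧ G.IsLink f.2 x.2 y.2
  isLink_symm _ _ := ⟨fun _ _ h ↦ ⟨h.2.1, h.1, h.2.2.symm⟩⟩
  eq_or_eq_of_isLink_of_isLink _ x y v w h h' :=
    (h.2.2.left_eq_or_eq h'.2.2).imp (fun H ↦ Prod.ext (h.1.symm.trans h'.1) H)
      (fun H ↦ Prod.ext (h.1.symm.trans h'.2.1) H)
  left_mem_of_isLink _ _ _ h := h.2.2.left_mem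

end Graph

namespace PetersenGluing

/-- The vertices `u_i` and `v_i` of the Petersen graph, with indices modulo `5`. -/
inductive PVertex
  | u (i : ZMod 5)
  | v (i : ZMod 5)
  deriving DecidableEq

open PVertex

/-- The Petersen graph: outer `5`-cycle `v_1 v_2 v_3 v_4 v_5`, inner `5`-cycle
`u_1 u_3 u_5 u_2 u_4`, and the five edges `u_i v_i`. -/
def petersen : SimpleGraph PVertex :=
  SimpleGraph.fromRel fun a b ↦
    (∃ i, a = v i ∧ b = v (i + 1)) ∨ (∃ i, a = u i ∧ b = u (i + 2)) ∨ ∃ i, a = u i ∧ b = v i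

/-- The perfect matching `M_0` of the Petersen graph. -/
def matchingZero : Set (Sym2 PVertex) := {e | ∃ i, e = s(u i, v i)}

/-- The perfect matching `M_i` of the Petersen graph, `i = 1, …, 5` modulo `5`: the only perfect
matching other than `M_0` that contains `u_i v_i`. It is obtained from `M_1` by adding `i - 1` to
all indices. -/
def matching (i : ZMod 5) : Set (Sym2 PVertex) :=
  {s(u i, v i), s(v (i + 1), v (i + 2)), s(v (i + 3), v (i + 4)),
    s(u (i + 1), u (i + 3)), s(u (i + 2), u (i + 4))}

/-- The indices of the matchings added to the Petersen graph in `P_k`. -/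
abbrev PIndex (k : ℕ) : Type := Fin k ⊕ (Fin (k - 1) ⊕ Fin (k - 1) ⊕ Fin (k - 1))

/-- The collection `k M_0 + (k - 1) (M_1 + M_3 + M_4)`. -/
def addedMatching (k : ℕ) : PIndex k → Set (Sym2 PVertex) :=
  Sum.elim (fun _ ↦ matchingZero)
    (Sum.elim (fun _ ↦ matching 1) (Sum.elim (fun _ ↦ matching 3) (fun _ ↦ matching 4)))

/-- The edges of `P_k`. -/
abbrev PEdge (k : ℕ) : Type := Sym2 PVertex × Option (PIndex k)

/-- The graph `P_k = P + k M_0 + (k - 1) (M_1 + M_3 + M_4)`. -/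
def graphP (k : ℕ) : Graph PVertex (PEdge k) :=
  (Graph.ofSimpleGraph petersen).addCopies (addedMatching k)

/-- The map identifying the two copies of `u_1`. -/
def identifyU (x : Fin 2 × PVertex) : Fin 2 × PVertex :=
  if x.2 = u 1 then (0, u 1) else x

/-- The graph `Q_k`: in two copies of `P_k` all edges between `u_1` and `v_1` are removed, and the
two copies of `u_1` are identified. The two copies of `v_1` are `(0, v 1)` and `(1, v 1)`. -/
def graphQ (k : ℕ) : Graph (Fin 2 × PVertex) (Fin 2 × PEdge k) :=
  ((graphP k).deleteEdges {e | (graphP k).IsLink e (u 1) (v 1)}).twoCopies.map identifyU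

/-- The graph `T_k`: a triangle with `k` parallel edges `(i, j)`, `j < k`, between `x_i` and
`x_{i+1}` for each `i` modulo `3`. -/
def graphT (k : ℕ) : Graph (ZMod 3) (ZMod 3 × Fin k) where
  vertexSet := Set.univ
  IsLink f x y := s(x, y) = s(f.1, f.1 + 1)
  isLink_symm _ _ := ⟨fun _ _ h ↦ Sym2.eq_swap.trans h⟩
  eq_or_eq_of_isLink_of_isLink _ _ _ _ _ h h' := by
    have := h.trans h'.symm
    grind
  left_mem_of_isLink _ _ _ _ := Set.mem_univ _

variable {α β : Type*}

/-- The choices made when the copies of `T_k` and `Q_k` are connected. If the vertex `w` is an end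
of the edge `e`, then the copy of `T_k` at `w` is connected, through its vertices `x_i` and
`x_{i+1}` with `i = slot w e`, to the copy `(side e w, v_1)` of `v_1` in the copy of `Q_k` at `e`.
The two conditions say exactly that each `x_i` and each copy of `v_1` is used as often as is
required for the resulting graph to be `4k`-regular. -/
structure Gluing (G : Graph α β) where
  slot : α → β → ZMod 3
  side : β → α → Fin 2
  bijOn_slot : ∀ w ∈ V(G), Set.BijOn (slot w) (G.incidenceSet w) Set.univ
  side_ne : ∀ e x y, G.IsLink e x y → side e x ≠ side e y

/-- The vertices of `S_k(G)`. -/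
inductive SVertex (α β : Type*)
  | ofT (w : α) (x : ZMod 3)
  | ofQ (e : β) (q : Fin 2 × PVertex)

/-- The edges of `S_k(G)`. -/
inductive SEdge (α β : Type*) (k : ℕ)
  | ofT (w : α) (f : ZMod 3 × Fin k)
  | ofQ (e : β) (f : Fin 2 × PEdge k)
  | connect (w : α) (e : β) (b : Fin 2) (j : Fin k)

/-- `SDart G A k f p q` says that the edge `f` of `S_k(G)` has ends `p` and `q`; for a connecting
edge, `p` is the end in a copy of `T_k`. For `w` an end of `e`, there are `k` connecting edges at
`x_i` (those with `b = 0`) and `k` at `x_{i+1}` (those with `b = 1`), where `i = slot w e`. -/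
inductive SDart (G : Graph α β) (A : Gluing G) (k : ℕ) :
    SEdge α β k → SVertex α β → SVertex α β → Prop
  | ofT {w f x y} : w ∈ V(G) → (graphT k).IsLink f x y →
      SDart G A k (.ofT w f) (.ofT w x) (.ofT w y)
  | ofQ {e f p q} : e ∈ E(G) → (graphQ k).IsLink f p q →
      SDart G A k (.ofQ e f) (.ofQ e p) (.ofQ e q)
  | connect {w e} (b : Fin 2) (j : Fin k) : G.Inc e w →
      SDart G A k (.connect w e b j) (.ofT w (A.slot w e + (b.val : ZMod 3)))
        (.ofQ e (A.side e w, v 1))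

/-- The graph `S_k(G)`: each vertex of `G` is replaced by a copy of `T_k`, each edge by a copy of
`Q_k`, and these are connected as prescribed by `A`. -/
def graphS (G : Graph α β) (A : Gluing G) (k : ℕ) : Graph (SVertex α β) (SEdge α β k) where
  vertexSet := {a | (∃ w ∈ V(G), ∃ x ∈ V(graphT k), a = .ofT w x) ∨
    ∃ e ∈ E(G), ∃ q ∈ V(graphQ k), a = .ofQ e q}
  IsLink f a b := SDart G A k f a b ∨ SDart G A k f b a
  isLink_symm _ _ := ⟨fun _ _ h ↦ h.symm⟩
  eq_or_eq_of_isLink_of_isLink := by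
    rintro f a b c d (h | h) (h' | h') <;> cases h <;> cases h' <;> simp <;>
      grind [Graph.IsLink.left_eq_or_eq, Graph.IsLink.right_eq_or_eq]
  left_mem_of_isLink := by
    have key : ∀ e w, G.Inc e w → (A.side e w, v 1) ∈ V(graphQ k) := fun e w _ ↦
      ⟨(A.side e w, v 1), trivial, by simp [identifyU]⟩
    rintro f a b (h | h) <;> cases h
    · exact .inl ⟨_, ‹_›, _, trivial, rfl⟩
    · exact .inr ⟨_, ‹_›, _, Graph.IsLink.left_mem ‹_›, rfl⟩
    · exact .inl ⟨_, Graph.Inc.vertex_mem ‹_›, _, trivial, rfl⟩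
    · exact .inl ⟨_, ‹_›, _, trivial, rfl⟩
    · exact .inr ⟨_, ‹_›, _, Graph.IsLink.right_mem ‹_›, rfl⟩
    · exact .inr ⟨_, Graph.Inc.edge_mem ‹_›, _, key _ _ ‹_›, rfl⟩

/-- Every cubic graph admits a gluing. -/
theorem nonempty_gluing {G : Graph α β} (hG : G.IsCubic) : Nonempty (Gluing G) := by
  classical
  have h1 : ∀ w ∈ V(G), ∃ f : β → ZMod 3, Set.BijOn f (G.incidenceSet w) Set.univ := by
    intro w hw
    have hc := hG.regular w hw
    have hf : (G.incidenceSet w).Finite := Set.finite_of_encard_eq_coe hc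
    refine Set.Finite.exists_bijOn_of_encard_eq hf ?_
    rw [hc, Set.encard_univ, ENat.card_eq_coe_fintype_card, ZMod.card]
  choose! s hs using h1
  have h2 : ∀ e, ∃ t : α → Fin 2, ∀ x y, G.IsLink e x y → t x ≠ t y := by
    intro e
    by_cases he : ∃ x y, G.IsLink e x y
    · obtain ⟨x, y, h⟩ := he
      have hxy : x ≠ y := fun H ↦ hG.loopless.not_isLoopAt e x (H ▸ h)
      refine ⟨fun a ↦ if a = x then 0 else 1, fun a b h' ↦ ?_⟩
      rcases h.eq_and_eq_or_eq_and_eq h' with ⟨rfl, rfl⟩ | ⟨rfl, rfl⟩ <;> simp [hxy.symm]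
    · exact ⟨fun _ ↦ 0, fun x y h ↦ (he ⟨x, y, h⟩).elim⟩
  choose t ht using h2
  exact ⟨s, t, hs, ht⟩

end PetersenGluing

/-!
The graph `S_k(G)` is handled through its classes of parallel edges: every edge of `S_k(G)` lies in
exactly one class, the ends of a class are explicit (`isLink_graphS_iff`), and so are the
multiplicities (`SClass.ncard_edges`) and the three or four classes at every vertex.

*Cuts.* Colour the vertices of `S_k(G)` with two colours. In `P_k` every cut has at least `4k` edges
(`PClass.four_mul_le_cutSum`), so after the deletion of the `2k` edges `u_1 v_1`, a copy of `P_k`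
that is not monochromatic contributes at least `2k` edges to the cut, and at least `4k` unless `u_1`
and `v_1` have different colours (`cutAt_inr`). The copy of `T_k` at a vertex `w` of `G`, together
with its connecting edges, contributes at least `2k` edges if the three attached copies of `v_1` do
not all have the same colour (`cutAt_inl_two`), and at least `4k` if they do but some `x_i` has
the other colour (`cutAt_inl_four`). So a cut with fewer than `4k` edges has at most one
contributing part. Following colours along a walk of `G` shows that, with exactly one such part,
`G` has a bridge (`not_exists_unique_mixed`, `not_exists_unique_change`); with none, `S_k(G)` is
monochromatic because `G` is connected. As `S_k(G)` has even order, it follows that it is a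
`4k`-graph.

*Matchings.* Let `4k - 2` pairwise disjoint perfect matchings be given. By parity, each of them
uses exactly one edge of the boundary of the copy of `Q_k` at an edge `e`, and induces a perfect
matching in both copies of `P_k` (`starSum_copyCount`); the edges that leave at `v_1` play the role
of `u_1 v_1`. The structure of the perfect matchings of the Petersen graph excludes that exactly
`2k - 2` of the matchings leave at a given copy of `v_1` (`PClass.ne_of_starSum_eq`). Since at most
`2k` leave there, and `4k - 2` leave in total, exactly `2k - 1` leave at either end of `e`
(`sum_connectCount`). Hence the matchings have `3 (2k - 1)` edges, an odd number, in the boundary of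
a copy of `T_k`; but each of the `4k - 2` matchings has an odd number of edges there.
-/

namespace PetersenGluing

open PVertex

/-! ### Parallel classes of edges -/

/-- The edges of the Petersen graph: `u_i v_i`, `v_i v_{i+1}` and `u_i u_{i+2}`. They index the
classes of parallel edges of `P_k`. -/
inductive PClass
  | spoke (i : ZMod 5)
  | outer (i : ZMod 5)
  | inner (i : ZMod 5)

namespace PClass

/-- The first end of an edge of the Petersen graph. -/
def fst : PClass → PVertex
  | spoke i => u i
  | outer i => v i
  | inner i => u i

/-- The second end of an edge of the Petersen graph. -/
def snd : PClass → PVertex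
  | spoke i => v i
  | outer i => v (i + 1)
  | inner i => u (i + 2)

/-- The edge of the Petersen graph as an unordered pair. -/
def edge (p : PClass) : Sym2 PVertex := s(p.fst, p.snd)

theorem edge_injective : Function.Injective edge := by
  have h1 : ∀ i j : ZMod 5, i = j + 1 → i + 1 = j → i = j := by decide
  have h2 : ∀ i j : ZMod 5, i = j + 2 → i + 2 = j → i = j := by decide
  rintro (i | i | i) (j | j | j) h <;> simp [edge, fst, snd] at h ⊢ <;> grind

theorem mem_edgeSet_petersen {e : Sym2 PVertex} :
    e ∈ petersen.edgeSet ↔ ∃ p : PClass, e = p.edge := by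
  have h1 : ∀ i : ZMod 5, i ≠ i + 1 := by decide
  have h2 : ∀ i : ZMod 5, i ≠ i + 2 := by decide
  induction e with | h a b => ?_
  simp only [petersen, SimpleGraph.mem_edgeSet, SimpleGraph.fromRel_adj]
  constructor
  · rintro ⟨-, (⟨i, rfl, rfl⟩ | ⟨i, rfl, rfl⟩ | ⟨i, rfl, rfl⟩) |
      (⟨i, rfl, rfl⟩ | ⟨i, rfl, rfl⟩ | ⟨i, rfl, rfl⟩)⟩
    · exact ⟨outer i, rfl⟩
    · exact ⟨inner i, rfl⟩
    · exact ⟨spoke i, rfl⟩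
    · exact ⟨outer i, Sym2.eq_swap⟩
    · exact ⟨inner i, Sym2.eq_swap⟩
    · exact ⟨spoke i, Sym2.eq_swap⟩
  · rintro ⟨i | i | i, h⟩ <;> simp [edge, fst, snd] at h <;>
      rcases h with ⟨rfl, rfl⟩ | ⟨rfl, rfl⟩ <;>
      simp [h1, h2, (h1 _).symm, (h2 _).symm]

theorem fst_ne_snd (p : PClass) : p.fst ≠ p.snd := by
  have h1 : ∀ i : ZMod 5, i ≠ i + 1 := by decide
  have h2 : ∀ i : ZMod 5, i ≠ i + 2 := by decide
  rcases p with i | i | i <;> simp [fst, snd, h1, h2]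

instance decidableMemMatching (e : Sym2 PVertex) (i : ZMod 5) : Decidable (e ∈ matching i) :=
  inferInstanceAs (Decidable (e = _ ∨ e = _ ∨ e = _ ∨ e = _ ∨ e = _))

/-- The number of parallel edges of `P_k` in each class, for `1 ≤ k`. -/
def mult (k : ℕ) : PClass → ℕ
  | spoke i => if i = 1 ∨ i = 3 ∨ i = 4 then 2 * k else k + 1
  | outer i => if i = 2 ∨ i = 4 then 2 * k - 1 else if i = 3 then 1 else k
  | inner i => if i = 0 then 2 * k - 1 else k

/-- The second components of the edges of `P_k` in a given class: `none` for the edge of the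
Petersen graph, `some i` for the copy added together with the `i`-th matching. -/
def copies (k : ℕ) (p : PClass) : Set (Option (PIndex k)) :=
  {o | ∀ i, o = some i → p.edge ∈ addedMatching k i}

theorem ncard_copies {k : ℕ} (hk : 1 ≤ k) (p : PClass) : (p.copies k).ncard = p.mult k := by
  classical
  have h0 : ∀ i, (spoke i).edge ∈ matchingZero := fun i ↦ ⟨i, rfl⟩
  have h1 : ∀ i, (outer i).edge ∉ matchingZero := by
    rintro i ⟨j, h⟩; simp [edge, fst, snd] at h
  have h2 : ∀ i, (inner i).edge ∉ matchingZero := by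
    rintro i ⟨j, h⟩; simp [edge, fst, snd] at h
  have key : (p.copies k).ncard = 1 + k * (if p.edge ∈ matchingZero then 1 else 0) +
      (k - 1) * ((if p.edge ∈ matching 1 then 1 else 0) + (if p.edge ∈ matching 3 then 1 else 0) +
        (if p.edge ∈ matching 4 then 1 else 0)) := by
    rw [← Nat.card_coe_set_eq, Nat.card_eq_fintype_card, Fintype.card_subtype, Finset.card_filter,
      Fintype.sum_option, Fintype.sum_sum_type, Fintype.sum_sum_type, Fintype.sum_sum_type]
    simp only [copies, addedMatching]
    simp
    split_ifs <;> simp <;> ring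
  rw [key]
  have hs : ∀ i, (if (spoke i).edge ∈ matching 1 then 1 else 0) +
      (if (spoke i).edge ∈ matching 3 then 1 else 0) +
      (if (spoke i).edge ∈ matching 4 then 1 else 0) =
        if i = 1 ∨ i = 3 ∨ i = 4 then 1 else 0 := by decide
  have ho : ∀ i, (if (outer i).edge ∈ matching 1 then 1 else 0) +
      (if (outer i).edge ∈ matching 3 then 1 else 0) +
      (if (outer i).edge ∈ matching 4 then 1 else 0) =
        if i = 2 ∨ i = 4 then 2 else if i = 3 then 0 else 1 := by decide
  have hi : ∀ i, (if (inner i).edge ∈ matching 1 then 1 else 0) +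
      (if (inner i).edge ∈ matching 3 then 1 else 0) +
      (if (inner i).edge ∈ matching 4 then 1 else 0) = if i = 0 then 2 else 1 := by decide
  rcases p with i | i | i
  · rw [if_pos (h0 i), hs, mult]
    split_ifs <;> omega
  · rw [if_neg (h1 i), ho, mult]
    split_ifs <;> omega
  · rw [if_neg (h2 i), hi, mult]
    split_ifs <;> omega

end PClass

variable {α β : Type*}

/-- The classes of parallel edges of `S_k(G)`: `tri w i` joins `x_i` and `x_{i+1}` in the copy of
`T_k` at `w`; `con w e b` consists of the edges `connect w e b j`; `pet e c p` is the class `p` of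
the `c`-th copy of `P_k` in the copy of `Q_k` at `e`. -/
inductive SClass (α β : Type*)
  | tri (w : α) (i : ZMod 3)
  | con (w : α) (e : β) (b : Fin 2)
  | pet (e : β) (c : Fin 2) (p : PClass)

namespace SClass

/-- The first end of the edges in a class. -/
def fst {G : Graph α β} (A : Gluing G) : SClass α β → SVertex α β
  | tri w i => .ofT w i
  | con w e b => .ofT w (A.slot w e + (b.val : ZMod 3))
  | pet e c p => .ofQ e (identifyU (c, p.fst))

/-- The second end of the edges in a class. -/
def snd {G : Graph α β} (A : Gluing G) : SClass α β → SVertex α β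
  | tri w i => .ofT w (i + 1)
  | con w e _ => .ofQ e (A.side e w, v 1)
  | pet e c p => .ofQ e (identifyU (c, p.snd))

/-- The classes that are present in `S_k(G)`. The class of `u_1 v_1` has been deleted. -/
def IsIn (G : Graph α β) : SClass α β → Prop
  | tri w _ => w ∈ V(G)
  | con w e _ => G.Inc e w
  | pet e _ p => e ∈ E(G) ∧ p ≠ .spoke 1

/-- The edges in a class. -/
def edges (k : ℕ) : SClass α β → Set (SEdge α β k)
  | tri w i => Set.range fun j ↦ .ofT w (i, j)
  | con w e b => Set.range fun j ↦ .connect w e b j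
  | pet e c p => (fun o ↦ .ofQ e (c, (p.edge, o))) '' p.copies k

/-- The number of edges in a class. -/
def mult (k : ℕ) : SClass α β → ℕ
  | tri _ _ => k
  | con _ _ _ => k
  | pet _ _ p => p.mult k

theorem ncard_edges {k : ℕ} (hk : 1 ≤ k) (C : SClass α β) : (C.edges k).ncard = C.mult k := by
  rcases C with ⟨w, i⟩ | ⟨w, e, b⟩ | ⟨e, c, p⟩
  · rw [edges, ← Set.image_univ, Set.ncard_image_of_injective _ (fun i j h ↦ by simpa using h)]
    simp [mult, Set.ncard_univ]
  · rw [edges, ← Set.image_univ, Set.ncard_image_of_injective _ (fun i j h ↦ by simpa using h)]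
    simp [mult, Set.ncard_univ]
  · rw [edges, Set.ncard_image_of_injective _ (fun i j h ↦ by simpa using h), mult,
      PClass.ncard_copies hk]

theorem finite_edges (k : ℕ) (C : SClass α β) : (C.edges k).Finite := by
  rcases C with ⟨w, i⟩ | ⟨w, e, b⟩ | ⟨e, c, p⟩
  · exact Set.finite_range _
  · exact Set.finite_range _
  · exact (Set.toFinite _).image _

theorem eq_of_mem_edges {k : ℕ} {f : SEdge α β k} {C D : SClass α β} (hC : f ∈ C.edges k)
    (hD : f ∈ D.edges k) : C = D := by
  rcases C with ⟨w, i⟩ | ⟨w, e, b⟩ | ⟨e, c, p⟩ <;>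
    rcases D with ⟨w', i'⟩ | ⟨w', e', b'⟩ | ⟨e', c', p'⟩ <;>
    simp only [edges, Set.mem_range, Set.mem_image] at hC hD <;> grind [PClass.edge_injective]

end SClass

theorem isLink_graphP_iff {k : ℕ} {f : PEdge k} {x y : PVertex} :
    (graphP k).IsLink f x y ↔ ∃ p : PClass, f.1 = p.edge ∧ f.2 ∈ p.copies k ∧ s(x, y) = p.edge := by
  simp only [graphP, Graph.addCopies, Graph.ofSimpleGraph, PClass.mem_edgeSet_petersen,
    PClass.copies]
  constructor
  · rintro ⟨⟨h, p, hp⟩, h'⟩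
    exact ⟨p, hp, hp ▸ h', h ▸ hp⟩
  · rintro ⟨p, hp, h', h⟩
    exact ⟨⟨hp.trans h.symm, p, hp⟩, hp ▸ h'⟩

theorem isLink_graphQ_iff {k : ℕ} {c : Fin 2} {f : PEdge k} {x y : Fin 2 × PVertex} :
    (graphQ k).IsLink (c, f) x y ↔ ∃ p : PClass, p ≠ .spoke 1 ∧ f.1 = p.edge ∧ f.2 ∈ p.copies k ∧
      s(x, y) = s(identifyU (c, p.fst), identifyU (c, p.snd)) := by
  simp only [graphQ, Graph.map, Relation.Map, Graph.twoCopies, Graph.deleteEdges_isLink,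
    isLink_graphP_iff, Set.mem_ofPred_eq]
  constructor
  · rintro ⟨⟨c', x⟩, ⟨c'', y⟩, ⟨h1, h2, ⟨p, hp, hp', hxy⟩, h3⟩, rfl, rfl⟩
    simp only at h1 h2 hp hxy h3
    subst h1 h2
    refine ⟨p, ?_, hp, hp', ?_⟩
    · rintro rfl
      exact h3 ⟨_, hp, hp', rfl⟩
    · rcases Sym2.eq_iff.1 hxy with ⟨rfl, rfl⟩ | ⟨rfl, rfl⟩
      · rfl
      · exact Sym2.eq_swap
  · rintro ⟨p, h1, hp, hp', h⟩
    have h3 : ¬ ∃ q : PClass, f.1 = q.edge ∧ f.2 ∈ q.copies k ∧ s(u 1, v 1) = q.edge := by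
      rintro ⟨q, hq, -, hq'⟩
      refine h1 (PClass.edge_injective (hp.symm.trans (hq.trans hq'.symm)))
    rcases Sym2.eq_iff.1 h with ⟨rfl, rfl⟩ | ⟨rfl, rfl⟩
    · exact ⟨(c, p.fst), (c, p.snd), ⟨rfl, rfl, ⟨p, hp, hp', rfl⟩, h3⟩, rfl, rfl⟩
    · exact ⟨(c, p.snd), (c, p.fst), ⟨rfl, rfl, ⟨p, hp, hp', Sym2.eq_swap⟩, h3⟩, rfl, rfl⟩

theorem isLink_graphS_iff {G : Graph α β} {A : Gluing G} {k : ℕ} {f : SEdge α β k}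
    {a b : SVertex α β} : (graphS G A k).IsLink f a b ↔
      ∃ C : SClass α β, C.IsIn G ∧ f ∈ C.edges k ∧ s(a, b) = s(C.fst A, C.snd A) := by
  have key : ∀ a b, SDart G A k f a b →
      ∃ C : SClass α β, C.IsIn G ∧ f ∈ C.edges k ∧ s(a, b) = s(C.fst A, C.snd A) := by
    rintro a b (@⟨w, ⟨i, j⟩, x, y, hw, h⟩ | @⟨e, ⟨c, f⟩, p, q, he, h⟩ | @⟨w, e, b, j, h⟩)
    · refine ⟨.tri w i, hw, ⟨j, rfl⟩, ?_⟩
      have : s(x, y) = s(i, i + 1) := h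
      rcases Sym2.eq_iff.1 this with ⟨rfl, rfl⟩ | ⟨rfl, rfl⟩
      · rfl
      · exact Sym2.eq_swap
    · obtain ⟨p, hp, h1, h2, h3⟩ := isLink_graphQ_iff.1 h
      refine ⟨.pet e c p, ⟨he, hp⟩, ⟨f.2, h2, by rw [← h1]⟩, ?_⟩
      rcases Sym2.eq_iff.1 h3 with ⟨rfl, rfl⟩ | ⟨rfl, rfl⟩
      · rfl
      · exact Sym2.eq_swap
    · exact ⟨.con w e b, h, ⟨j, rfl⟩, rfl⟩
  constructor
  · rintro (h | h)
    · exact key _ _ h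
    · obtain ⟨C, h1, h2, h3⟩ := key _ _ h
      exact ⟨C, h1, h2, Sym2.eq_swap.trans h3⟩
  · rintro ⟨C, h1, h2, h3⟩
    have : SDart G A k f (C.fst A) (C.snd A) := by
      rcases C with ⟨w, i⟩ | ⟨w, e, b⟩ | ⟨e, c, p⟩
      · obtain ⟨j, rfl⟩ := h2
        exact .ofT h1 rfl
      · obtain ⟨j, rfl⟩ := h2
        exact .connect b j h1
      · obtain ⟨o, ho, rfl⟩ := h2
        exact .ofQ h1.1 (isLink_graphQ_iff.2 ⟨p, h1.2, rfl, ho, rfl⟩)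
    rcases Sym2.eq_iff.1 h3 with ⟨rfl, rfl⟩ | ⟨rfl, rfl⟩
    · exact .inl this
    · exact .inr this

/-! ### Incidence sets -/

namespace PClass

/-- The three edges of the Petersen graph at a vertex. -/
def star (x : PVertex) : List PClass :=
  match x with
  | u i => [spoke i, inner i, inner (i - 2)]
  | v i => [spoke i, outer i, outer (i - 1)]

theorem mem_star {x : PVertex} {p : PClass} : p ∈ PClass.star x ↔ p.fst = x ∨ p.snd = x := by
  rcases x with i | i <;> rcases p with j | j | j <;>
    simp [PClass.star, fst, snd, eq_sub_iff_add_eq]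

theorem nodup_star (x : PVertex) : (PClass.star x).Nodup := by
  have h1 : ∀ i : ZMod 5, i ≠ i - 1 := by decide
  have h2 : ∀ i : ZMod 5, i ≠ i - 2 := by decide
  rcases x with i | i <;> simp [PClass.star, h1, h2]

theorem sum_mult_star {k : ℕ} (hk : 1 ≤ k) (x : PVertex) :
    ((PClass.star x).map (mult k)).sum = 4 * k := by
  have h5 : ∀ i : ZMod 5, i = 0 ∨ i = 1 ∨ i = 2 ∨ i = 3 ∨ i = 4 := by decide
  rcases x with i | i <;> rcases h5 i with rfl | rfl | rfl | rfl | rfl <;>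
    simp +decide [PClass.star, mult] <;> omega

end PClass

theorem identifyU_eq_iff {c c' : Fin 2} {x y : PVertex} (hx : x ≠ u 1) :
    identifyU (c', y) = (c, x) ↔ c' = c ∧ y = x := by
  unfold identifyU
  split_ifs with h
  · simp at h ⊢
    grind
  · simp

theorem identifyU_eq_zero_iff {c : Fin 2} {y : PVertex} :
    identifyU (c, y) = (0, u 1) ↔ y = u 1 := by
  unfold identifyU
  split_ifs with h
  · simpa using h
  · simp at h ⊢
    grind

theorem mem_vertexSet_graphQ {k : ℕ} {q : Fin 2 × PVertex} :
    q ∈ V(graphQ k) ↔ q.2 ≠ u 1 ∨ q = (0, u 1) := by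
  have : q ∈ V(graphQ k) ↔ ∃ q' : Fin 2 × PVertex, identifyU q' = q :=
    ⟨fun ⟨q', _, h⟩ ↦ ⟨q', h⟩, fun ⟨q', h⟩ ↦ ⟨q', trivial, h⟩⟩
  rw [this]
  constructor
  · rintro ⟨q', rfl⟩
    unfold identifyU
    split_ifs with h
    · exact .inr rfl
    · exact .inl h
  · rintro (h | rfl)
    · exact ⟨q, if_neg h⟩
    · exact ⟨(0, u 1), if_pos rfl⟩

/-- In each of its three slots, the copy of `T_k` at `w` is connected to exactly one edge. -/
theorem Gluing.exists_slotEdge {G : Graph α β} (A : Gluing G) {w : α} (hw : w ∈ V(G)) :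
    ∃ ε : ZMod 3 → β, (∀ i, G.Inc (ε i) w ∧ A.slot w (ε i) = i) ∧
      ∀ e, G.Inc e w → e = ε (A.slot w e) := by
  have h := A.bijOn_slot w hw
  choose ε hε using fun i ↦ h.surjOn (Set.mem_univ i)
  exact ⟨ε, hε, fun e he ↦ h.injOn he (hε _).1 (hε _).2.symm⟩

/-- Each of the two copies of `v_1` in the copy of `Q_k` at `e` is used for exactly one end. -/
theorem Gluing.exists_end {G : Graph α β} (A : Gluing G) {e : β} (he : e ∈ E(G)) (c : Fin 2) :
    ∃ w, G.Inc e w ∧ A.side e w = c ∧ ∀ w', G.Inc e w' → A.side e w' = c → w' = w := by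
  obtain ⟨x, y, h⟩ := G.exists_isLink_of_mem_edgeSet he
  have hxy := A.side_ne e x y h
  have hend : ∀ w, G.Inc e w → w = x ∨ w = y := fun w hw ↦ hw.eq_or_eq_of_isLink h
  by_cases hc : A.side e x = c
  · refine ⟨x, h.inc_left, hc, fun w hw hwc ↦ (hend w hw).resolve_right ?_⟩
    rintro rfl; exact hxy (hc.trans hwc.symm)
  · refine ⟨y, h.inc_right, by omega, fun w hw hwc ↦ (hend w hw).resolve_left ?_⟩
    rintro rfl; exact hc hwc

/-- `C.At A a` says that the class `C` is present in `S_k(G)` and that `a` is an end of it. -/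
def SClass.At {G : Graph α β} (A : Gluing G) (C : SClass α β) (a : SVertex α β) : Prop :=
  C.IsIn G ∧ (C.fst A = a ∨ C.snd A = a)

theorem inc_graphS_iff {G : Graph α β} {A : Gluing G} {k : ℕ} {f : SEdge α β k}
    {a : SVertex α β} : (graphS G A k).Inc f a ↔ ∃ C : SClass α β, C.At A a ∧ f ∈ C.edges k := by
  simp only [Graph.Inc, isLink_graphS_iff, SClass.At]
  constructor
  · rintro ⟨b, C, h1, h2, h3⟩
    rcases Sym2.eq_iff.1 h3 with ⟨rfl, rfl⟩ | ⟨rfl, rfl⟩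
    · exact ⟨C, ⟨h1, .inl rfl⟩, h2⟩
    · exact ⟨C, ⟨h1, .inr rfl⟩, h2⟩
  · rintro ⟨C, ⟨h1, rfl | rfl⟩, h2⟩
    · exact ⟨_, C, h1, h2, rfl⟩
    · exact ⟨_, C, h1, h2, Sym2.eq_swap⟩

/-- The number of edges of `M` in a class. -/
noncomputable def SClass.count {k : ℕ} (M : Set (SEdge α β k)) (C : SClass α β) : ℕ :=
  (M ∩ C.edges k).ncard

theorem SClass.ncard_inter_biUnion {k : ℕ} (M : Set (SEdge α β k)) {L : List (SClass α β)}
    (hL : L.Nodup) : (M ∩ ⋃ C ∈ L, C.edges k).ncard = (L.map (count M)).sum := by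
  induction L with
  | nil => simp
  | cons D L ih =>
    have hD := List.nodup_cons.1 hL
    have hfin : (⋃ C ∈ L, C.edges k).Finite :=
      (List.finite_toSet L).biUnion fun C _ ↦ C.finite_edges k
    rw [List.map_cons, List.sum_cons, ← ih hD.2, count, ← Set.ncard_union_eq _
      ((D.finite_edges k).inter_of_right M) (hfin.inter_of_right M), ← Set.inter_union_distrib_left]
    · simp
    · refine Set.disjoint_left.2 fun f hf hf' ↦ ?_
      obtain ⟨C, hC, hfC⟩ := Set.mem_iUnion₂.1 hf'.2
      exact hD.1 (SClass.eq_of_mem_edges hf.2 hfC ▸ hC)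

theorem ncard_inter_incidenceSet {G : Graph α β} {A : Gluing G} {k : ℕ} (M : Set (SEdge α β k))
    {a : SVertex α β} {L : List (SClass α β)} (hL : L.Nodup)
    (h : ∀ C : SClass α β, C ∈ L ↔ C.At A a) :
    (M ∩ (graphS G A k).incidenceSet a).ncard = (L.map (SClass.count M)).sum := by
  rw [← SClass.ncard_inter_biUnion M hL]
  congr 2
  ext f
  simp [inc_graphS_iff, h]

theorem finite_incidenceSet {G : Graph α β} {A : Gluing G} {k : ℕ}
    {a : SVertex α β} {L : List (SClass α β)} (h : ∀ C : SClass α β, C ∈ L ↔ C.At A a) :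
    ((graphS G A k).incidenceSet a).Finite := by
  refine ((List.finite_toSet L).biUnion fun C _ ↦ C.finite_edges k).subset fun f hf ↦ ?_
  obtain ⟨C, hC, hf⟩ := inc_graphS_iff.1 hf
  exact Set.mem_biUnion ((h C).2 hC) hf

section At

variable {G : Graph α β} (A : Gluing G)

/-- The classes at a vertex `x_i` of a copy of `T_k`. Here `ε i` is the edge in slot `i` of `w`,
which is connected to `x_i` and `x_{i+1}`. -/
theorem at_ofT {w : α} (hw : w ∈ V(G)) {ε : ZMod 3 → β}
    (h1 : ∀ i, G.Inc (ε i) w ∧ A.slot w (ε i) = i) (h2 : ∀ e, G.Inc e w → e = ε (A.slot w e))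
    (x : ZMod 3) (C : SClass α β) :
    C ∈ [.tri w x, .tri w (x - 1), .con w (ε x) 0, .con w (ε (x - 1)) 1] ↔ C.At A (.ofT w x) := by
  rcases C with ⟨w', i⟩ | ⟨w', e, b⟩ | ⟨e, c, p⟩
  · simp only [SClass.At, SClass.IsIn, SClass.fst, SClass.snd]
    simp [eq_sub_iff_add_eq]
    grind
  · simp only [SClass.At, SClass.IsIn, SClass.fst, SClass.snd]
    fin_cases b
    · simp; grind
    · simp [← eq_sub_iff_add_eq]; grind
  · simp [SClass.At, SClass.fst, SClass.snd]

theorem at_ofQ {e : β} (he : e ∈ E(G)) (c : Fin 2) {x : PVertex} (hu : x ≠ u 1) (hv : x ≠ v 1)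
    (C : SClass α β) : C ∈ (PClass.star x).map (.pet e c) ↔ C.At A (.ofQ e (c, x)) := by
  rcases C with ⟨w', i⟩ | ⟨w', e, b⟩ | ⟨e', c', p⟩
  · simp [SClass.At, SClass.fst, SClass.snd]
  · simp [SClass.At, SClass.fst, SClass.snd, hv.symm]
  · simp only [SClass.At, SClass.IsIn, SClass.fst, SClass.snd, List.mem_map, SVertex.ofQ.injEq,
      SClass.pet.injEq, identifyU_eq_iff hu]
    have : p = .spoke 1 → p.fst ≠ x ∧ p.snd ≠ x := by
      rintro rfl; exact ⟨hu.symm, hv.symm⟩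
    grind [PClass.mem_star]

/-- The classes at the vertex that arises from the two copies of `u_1`. -/
theorem at_ofQ_u {e : β} (he : e ∈ E(G)) (C : SClass α β) :
    C ∈ [.pet e 0 (.inner 1), .pet e 0 (.inner 4), .pet e 1 (.inner 1), .pet e 1 (.inner 4)] ↔
      C.At A (.ofQ e (0, u 1)) := by
  rcases C with ⟨w', i⟩ | ⟨w', e, b⟩ | ⟨e', c', p⟩
  · simp [SClass.At, SClass.fst, SClass.snd]
  · simp [SClass.At, SClass.fst, SClass.snd]
  · simp only [SClass.At, SClass.IsIn, SClass.fst, SClass.snd, SVertex.ofQ.injEq,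
      identifyU_eq_zero_iff]
    have hp : p.fst = u 1 ∨ p.snd = u 1 ↔ p ∈ PClass.star (u 1) := PClass.mem_star.symm
    have h4 : (1 - 2 : ZMod 5) = 4 := by decide
    have hc : c' = 0 ∨ c' = 1 := by omega
    simp [PClass.star, h4] at hp ⊢
    grind

/-- The classes at a copy of `v_1`, where `w` is the end of `e` that is connected to this copy. -/
theorem at_ofQ_v {e : β} (he : e ∈ E(G)) (c : Fin 2) {w : α} (h1 : G.Inc e w)
    (h2 : A.side e w = c) (h3 : ∀ w', G.Inc e w' → A.side e w' = c → w' = w) (C : SClass α β) :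
    C ∈ [.pet e c (.outer 1), .pet e c (.outer 0), .con w e 0, .con w e 1] ↔
      C.At A (.ofQ e (c, v 1)) := by
  rcases C with ⟨w', i⟩ | ⟨w', e', b⟩ | ⟨e', c', p⟩
  · simp [SClass.At, SClass.fst, SClass.snd]
  · have hb : b = 0 ∨ b = 1 := by omega
    simp [SClass.At, SClass.IsIn, SClass.fst, SClass.snd]
    grind
  · simp only [SClass.At, SClass.IsIn, SClass.fst, SClass.snd, SVertex.ofQ.injEq,
      identifyU_eq_iff (show v 1 ≠ u 1 by simp)]
    have hp : p.fst = v 1 ∨ p.snd = v 1 ↔ p ∈ PClass.star (v 1) := PClass.mem_star.symm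
    simp [PClass.star] at hp ⊢
    grind

end At

/-! ### Degrees, finiteness and parity of the order -/

theorem SClass.count_univ {k : ℕ} (hk : 1 ≤ k) (C : SClass α β) :
    count (Set.univ : Set (SEdge α β k)) C = C.mult k := by
  rw [count, Set.univ_inter, ncard_edges hk]

theorem mem_vertexSet_graphS {G : Graph α β} {A : Gluing G} {k : ℕ} {a : SVertex α β} :
    a ∈ V(graphS G A k) ↔ (∃ w ∈ V(G), ∃ x, a = .ofT w x) ∨
      ∃ e ∈ E(G), ∃ q ∈ V(graphQ k), a = .ofQ e q := by
  simp only [graphS, graphT, Set.mem_univ, true_and]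
  rfl

/-- At every vertex of `S_k(G)`, the multiplicities of the classes add up to `4k`. -/
theorem exists_classes_at {G : Graph α β} (A : Gluing G) {k : ℕ} (hk : 1 ≤ k) {a : SVertex α β}
    (ha : a ∈ V(graphS G A k)) : ∃ L : List (SClass α β), L.Nodup ∧ (∀ C, C ∈ L ↔ C.At A a) ∧
      (L.map (SClass.mult k)).sum = 4 * k := by
  rcases mem_vertexSet_graphS.1 ha with ⟨w, hw, x, rfl⟩ | ⟨e, he, ⟨c, x⟩, hq, rfl⟩
  · obtain ⟨ε, h1, h2⟩ := A.exists_slotEdge hw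
    have hx : ∀ x : ZMod 3, x ≠ x - 1 := by decide
    refine ⟨_, ?_, at_ofT A hw h1 h2 x, ?_⟩
    · simp [hx]
    · simp [SClass.mult]
      omega
  · rcases mem_vertexSet_graphQ.1 hq with hu | hu
    · by_cases hv : x = v 1
      · subst hv
        obtain ⟨w, h1, h2, h3⟩ := A.exists_end he c
        refine ⟨_, ?_, at_ofQ_v A he c h1 h2 h3, ?_⟩
        · simp +decide
        · simp +decide [SClass.mult, PClass.mult]
          omega
      · refine ⟨_, (PClass.nodup_star x).map fun p q h ↦ by simpa using h, at_ofQ A he c hu hv, ?_⟩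
        rw [List.map_map]
        exact PClass.sum_mult_star hk x
    · rw [hu]
      refine ⟨_, ?_, at_ofQ_u A he, ?_⟩
      · simp +decide
      · simp +decide [SClass.mult, PClass.mult]
        omega

theorem isRegular_graphS {G : Graph α β} (A : Gluing G) {k : ℕ} (hk : 1 ≤ k) :
    (graphS G A k).IsRegular (4 * k) := by
  intro a ha
  obtain ⟨L, hL, h, hsum⟩ := exists_classes_at A hk ha
  rw [← (finite_incidenceSet h).cast_ncard_eq]
  have := ncard_inter_incidenceSet (k := k) Set.univ hL h
  rw [Set.univ_inter] at this
  rw [this, ← hsum, List.map_congr_left fun C _ ↦ SClass.count_univ hk C]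

instance : Finite PVertex :=
  Finite.of_injective (β := Bool × ZMod 5)
    (fun | u i => (true, i) | v i => (false, i)) (by rintro (i | i) (j | j) h <;> simp_all)

theorem vertexSet_graphS_eq {G : Graph α β} (A : Gluing G) (k : ℕ) :
    V(graphS G A k) = (fun p : α × ZMod 3 ↦ SVertex.ofT p.1 p.2) '' (V(G) ×ˢ Set.univ) ∪
      (fun p : β × Fin 2 × PVertex ↦ SVertex.ofQ p.1 p.2) '' (E(G) ×ˢ V(graphQ k)) := by
  ext a
  rw [mem_vertexSet_graphS]
  constructor
  · rintro (⟨w, hw, x, rfl⟩ | ⟨e, he, q, hq, rfl⟩)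
    · exact .inl ⟨(w, x), ⟨hw, trivial⟩, rfl⟩
    · exact .inr ⟨(e, q), ⟨he, hq⟩, rfl⟩
  · rintro (⟨⟨w, x⟩, h, rfl⟩ | ⟨⟨e, q⟩, h, rfl⟩)
    · exact .inl ⟨w, h.1, x, rfl⟩
    · exact .inr ⟨e, h.1, q, h.2, rfl⟩

theorem isFiniteLoopless_graphS {G : Graph α β} (hG : G.IsFiniteLoopless) (A : Gluing G) {k : ℕ}
    (hk : 1 ≤ k) : (graphS G A k).IsFiniteLoopless := by
  have hV : V(graphS G A k).Finite := by
    rw [vertexSet_graphS_eq]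
    exact ((hG.finite_vertexSet.prod Set.finite_univ).image _).union
      ((hG.finite_edgeSet.prod (Set.toFinite _)).image _)
  refine ⟨hV, ?_, ⟨?_⟩⟩
  · refine (hV.biUnion (t := (graphS G A k).incidenceSet) fun a ha ↦ ?_).subset fun f hf ↦ ?_
    · obtain ⟨L, -, h, -⟩ := exists_classes_at A hk ha
      exact finite_incidenceSet h
    · obtain ⟨a, b, h⟩ := Graph.exists_isLink_of_mem_edgeSet hf
      exact Set.mem_biUnion h.left_mem h.inc_left
  · intro f a h
    obtain ⟨C, h1, -, h3⟩ := isLink_graphS_iff.1 h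
    have : C.fst A = C.snd A := by grind
    rcases C with ⟨w, i⟩ | ⟨w, e, b⟩ | ⟨e, c, p⟩
    · revert this
      simp [SClass.fst, SClass.snd]
    · simp [SClass.fst, SClass.snd] at this
    · have h' : identifyU (c, p.fst) = identifyU (c, p.snd) := by
        simpa [SClass.fst, SClass.snd] using this
      by_cases hu : p.snd = u 1
      · have h0 : identifyU (c, p.snd) = (0, u 1) := if_pos hu
        rw [h0, identifyU_eq_zero_iff] at h'
        exact p.fst_ne_snd (h'.trans hu.symm)
      · have h0 : identifyU (c, p.snd) = (c, p.snd) := if_neg hu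
        rw [h0, identifyU_eq_iff hu] at h'
        exact p.fst_ne_snd h'.2

/-- The handshake lemma for cubic graphs; both sides count the pairs of an edge and an end. -/
theorem Gluing.three_mul_ncard {G : Graph α β} (A : Gluing G) :
    V(G).ncard * 3 = E(G).ncard * 2 := by
  have h1 : Set.BijOn (fun p : α × β ↦ (p.1, A.slot p.1 p.2)) {p | G.Inc p.2 p.1}
      (V(G) ×ˢ Set.univ) := by
    refine ⟨fun p hp ↦ ⟨hp.vertex_mem, trivial⟩, ?_, ?_⟩
    · rintro ⟨w, e⟩ he ⟨w', e'⟩ he' h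
      simp only [Prod.mk.injEq] at h
      obtain ⟨rfl, h⟩ := h
      exact Prod.ext rfl ((A.bijOn_slot w (Graph.Inc.vertex_mem he)).injOn he he' h)
    · rintro ⟨w, i⟩ ⟨hw, -⟩
      obtain ⟨e, he, h⟩ := (A.bijOn_slot w hw).surjOn (Set.mem_univ i)
      exact ⟨(w, e), he, Prod.ext rfl h⟩
  have h2 : Set.BijOn (fun p : α × β ↦ (p.2, A.side p.2 p.1)) {p | G.Inc p.2 p.1}
      (E(G) ×ˢ Set.univ) := by
    refine ⟨fun p hp ↦ ⟨hp.edge_mem, trivial⟩, ?_, ?_⟩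
    · rintro ⟨w, e⟩ he ⟨w', e'⟩ he' h
      simp only [Prod.mk.injEq] at h
      obtain ⟨rfl, h⟩ := h
      obtain ⟨w₀, -, -, h0⟩ := A.exists_end (Graph.Inc.edge_mem he) (A.side e w)
      exact Prod.ext ((h0 w he rfl).trans (h0 w' he' h.symm).symm) rfl
    · rintro ⟨e, c⟩ ⟨he, -⟩
      obtain ⟨w, hw, h, -⟩ := A.exists_end he c
      exact ⟨(w, e), hw, Prod.ext rfl h⟩
  have h := h1.ncard_eq.symm.trans h2.ncard_eq
  rw [Set.ncard_prod, Set.ncard_prod] at h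
  simpa [Set.ncard_univ] using h

theorem even_ncard_vertexSet_graphS {G : Graph α β} (hG : G.IsFiniteLoopless) (A : Gluing G)
    (heven : Even E(G).ncard) (k : ℕ) : Even V(graphS G A k).ncard := by
  have hT := (hG.finite_vertexSet.prod (Set.finite_univ (α := ZMod 3))).image
    fun p ↦ (SVertex.ofT p.1 p.2 : SVertex α β)
  have hQ := (hG.finite_edgeSet.prod (Set.toFinite V(graphQ k))).image
    fun p ↦ (SVertex.ofQ p.1 p.2 : SVertex α β)
  rw [vertexSet_graphS_eq, Set.ncard_union_eq _ hT hQ, Set.ncard_image_of_injective,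
    Set.ncard_image_of_injective, Set.ncard_prod, Set.ncard_prod, Set.ncard_univ, Nat.card_zmod,
    A.three_mul_ncard]
  · exact (heven.mul_right _).add (heven.mul_right _)
  · rintro ⟨e, q⟩ ⟨e', q'⟩ h
    simpa using h
  · rintro ⟨e, q⟩ ⟨e', q'⟩ h
    simpa using h
  · refine Set.disjoint_left.2 ?_
    rintro _ ⟨p, -, rfl⟩ ⟨q, -, h⟩
    simp at h

/-! ### Perfect matchings of the Petersen graph -/

namespace PClass

/-- The sum of the values of `f` on the edges of the Petersen graph at `x`. -/
def starSum (f : PClass → ℕ) (x : PVertex) : ℕ := ((PClass.star x).map f).sum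

theorem starSum_eq (f : PClass → ℕ) :
    starSum f (u 0) = f (spoke 0) + f (inner 0) + f (inner 3) ∧
    starSum f (u 1) = f (spoke 1) + f (inner 1) + f (inner 4) ∧
    starSum f (u 2) = f (spoke 2) + f (inner 2) + f (inner 0) ∧
    starSum f (u 3) = f (spoke 3) + f (inner 3) + f (inner 1) ∧
    starSum f (u 4) = f (spoke 4) + f (inner 4) + f (inner 2) ∧
    starSum f (v 0) = f (spoke 0) + f (outer 0) + f (outer 4) ∧
    starSum f (v 1) = f (spoke 1) + f (outer 1) + f (outer 0) ∧
    starSum f (v 2) = f (spoke 2) + f (outer 2) + f (outer 1) ∧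
    starSum f (v 3) = f (spoke 3) + f (outer 3) + f (outer 2) ∧
    starSum f (v 4) = f (spoke 4) + f (outer 4) + f (outer 3) := by
  refine ⟨?_, ?_, ?_, ?_, ?_, ?_, ?_, ?_, ?_, ?_⟩ <;>
    simp [starSum, PClass.star, add_assoc] <;> rfl

theorem starSum_sum {ι : Type*} (s : Finset ι) (f : ι → PClass → ℕ) (x : PVertex) :
    starSum (fun p ↦ ∑ i ∈ s, f i p) x = ∑ i ∈ s, starSum (f i) x := by
  rcases x with i | i <;> simp [starSum, PClass.star, Finset.sum_add_distrib]

/-- Since the Petersen graph has an even number of vertices, an edge set that covers every vertex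
other than `u_1` exactly once, and `u_1` at most once apart from the edge `u_1 v_1`, is a perfect
matching. -/
theorem starSum_u_one {f : PClass → ℕ} (h : ∀ x ≠ u 1, starSum f x = 1)
    (h1 : f (inner 1) + f (inner 4) ≤ 1) : f (spoke 1) + f (inner 1) + f (inner 4) = 1 := by
  obtain ⟨e0, e1, e2, e3, e4, e5, e6, e7, e8, e9⟩ := starSum_eq f
  have h0 := h (u 0) (by decide)
  have h2 := h (u 2) (by decide)
  have h3 := h (u 3) (by decide)
  have h4 := h (u 4) (by decide)
  have h5 := h (v 0) (by decide)
  have h6 := h (v 1) (by decide)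
  have h7 := h (v 2) (by decide)
  have h8 := h (v 3) (by decide)
  have h9 := h (v 4) (by decide)
  omega

/-- The perfect matchings that contain exactly two of the edges `u_0 u_2`, `u_4 u_1`, `v_0 v_1` are
`M_2`, `M_3` and `M_4`; the others contain none of them. -/
theorem even_of_starSum_eq_one {f : PClass → ℕ} (h : ∀ x, starSum f x = 1) :
    Even (f (inner 0) + f (inner 4) + f (outer 0)) := by
  obtain ⟨e0, e1, e2, e3, e4, e5, e6, e7, e8, e9⟩ := starSum_eq f
  simp only [h] at e0 e1 e2 e3 e4 e5 e6 e7 e8 e9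
  -- The edges on the outer cycle determine those on the spokes, and these, as the inner cycle is
  -- odd, determine those on the inner cycle.
  have a0 : f (outer 0) = 0 ∨ f (outer 0) = 1 := by omega
  have a1 : f (outer 1) = 0 ∨ f (outer 1) = 1 := by omega
  have a2 : f (outer 2) = 0 ∨ f (outer 2) = 1 := by omega
  have a3 : f (outer 3) = 0 ∨ f (outer 3) = 1 := by omega
  have a4 : f (outer 4) = 0 ∨ f (outer 4) = 1 := by omega
  rw [Nat.even_iff]
  rcases a0 with a0 | a0 <;> rcases a1 with a1 | a1 <;> rcases a2 with a2 | a2 <;>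
    rcases a3 with a3 | a3 <;> rcases a4 with a4 | a4 <;> omega

/-- Among `4k - 2` perfect matchings of `P_k` that are disjoint outside the class of `u_1 v_1`, the
number of those that contain an edge of this class is not `2k - 2`. Here `f` counts the edges of
their union in every class. If `n_i` of the matchings project to `M_i`, then
`n_2 + n_3 + n_4 + n_5 = 2k` would force `n_2 + n_3 = n_2 + n_4` and `n_3 + n_4 = 2k - 1`. -/
theorem ne_of_starSum_eq {k : ℕ} (hk : 1 ≤ k) {f : PClass → ℕ} (h : ∀ x, starSum f x = 4 * k - 2)
    (heven : Even (f (inner 0) + f (inner 4) + f (outer 0)))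
    (hf : ∀ p ≠ spoke 1, f p ≤ mult k p) : f (spoke 1) ≠ 2 * k - 2 := by
  obtain ⟨e0, e1, e2, e3, e4, e5, e6, e7, e8, e9⟩ := starSum_eq f
  simp only [h] at e0 e1 e2 e3 e4 e5 e6 e7 e8 e9
  have b0 : f (inner 0) ≤ 2 * k - 1 := hf _ (by simp)
  have b1 : f (inner 1) ≤ k := hf _ (by simp)
  have b4 : f (inner 4) ≤ k := hf _ (by simp)
  have c0 : f (outer 0) ≤ k := hf _ (by simp)
  have c1 : f (outer 1) ≤ k := hf _ (by simp)
  have c3 : f (outer 3) ≤ 1 := hf _ (by simp)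
  rw [Nat.even_iff] at heven
  omega

end PClass

/-! ### Perfect matchings of `S_k(G)` -/

section Matching

variable {G : Graph α β} {A : Gluing G} {k : ℕ} {M : Set (SEdge α β k)}

theorem sum_count_eq_one (hM : (graphS G A k).IsPerfectMatching M) {a : SVertex α β}
    (ha : a ∈ V(graphS G A k)) {L : List (SClass α β)} (hL : L.Nodup)
    (h : ∀ C : SClass α β, C ∈ L ↔ C.At A a) : (L.map (SClass.count M)).sum = 1 := by
  rw [← ncard_inter_incidenceSet M hL h, Set.ncard_eq_one]
  obtain ⟨f, hf, hf'⟩ := hM.2 a ha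
  exact ⟨f, Set.eq_singleton_iff_unique_mem.2 ⟨hf, hf'⟩⟩

/-- The number of edges of `M` that connect the copy of `Q_k` at `e` with the copy of `T_k` at
`w`. -/
noncomputable def connectCount (M : Set (SEdge α β k)) (w : α) (e : β) : ℕ :=
  SClass.count M (.con w e 0) + SClass.count M (.con w e 1)

open Classical in
/-- The number of edges of `M` in each class of a copy of `P_k` in the copy of `Q_k` at `e`, where
the edges that connect the copy of `v_1` with the copy of `T_k` at `w` play the role of the deleted
edges `u_1 v_1`. -/
noncomputable def copyCount (M : Set (SEdge α β k)) (w : α) (e : β) (c : Fin 2) (p : PClass) : ℕ :=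
  if p = .spoke 1 then connectCount M w e else SClass.count M (.pet e c p)

theorem copyCount_spoke_one (w : α) (e : β) (c : Fin 2) :
    copyCount M w e c (.spoke 1) = connectCount M w e := if_pos rfl

theorem copyCount_of_ne (w : α) (e : β) (c : Fin 2) {p : PClass} (hp : p ≠ .spoke 1) :
    copyCount M w e c p = SClass.count M (.pet e c p) := if_neg hp

/-- A perfect matching of `S_k(G)` contains exactly one edge of the boundary of the copy of `Q_k` at
`e`, and it induces perfect matchings in both copies of `P_k`. -/
theorem starSum_copyCount (hM : (graphS G A k).IsPerfectMatching M) {e : β} (he : e ∈ E(G))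
    {w : Fin 2 → α} (h1 : ∀ c, G.Inc e (w c)) (h2 : ∀ c, A.side e (w c) = c)
    (h3 : ∀ c w', G.Inc e w' → A.side e w' = c → w' = w c) :
    (∀ c x, PClass.starSum (copyCount M (w c) e c) x = 1) ∧
      connectCount M (w 0) e + connectCount M (w 1) e = 1 := by
  have hu : ∀ c, copyCount M (w c) e c (.inner 1) + copyCount M (w c) e c (.inner 4) =
    SClass.count M (.pet e c (.inner 1)) + SClass.count M (.pet e c (.inner 4)) := fun c ↦ by
    rw [copyCount_of_ne _ _ _ (by simp), copyCount_of_ne _ _ _ (by simp)]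
  have hsum := sum_count_eq_one hM (a := .ofQ e (0, u 1)) (mem_vertexSet_graphS.2 <| .inr
    ⟨e, he, _, mem_vertexSet_graphQ.2 (.inr rfl), rfl⟩) (by simp +decide) (at_ofQ_u A he)
  simp only [List.map_cons, List.map_nil, List.sum_cons, List.sum_nil] at hsum
  have hne : ∀ c, ∀ x ≠ u 1, PClass.starSum (copyCount M (w c) e c) x = 1 := by
    intro c x hx
    have hmem : SVertex.ofQ e (c, x) ∈ V(graphS G A k) := mem_vertexSet_graphS.2 <| .inr
      ⟨e, he, _, mem_vertexSet_graphQ.2 (.inl hx), rfl⟩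
    by_cases hv : x = v 1
    · subst hv
      have := sum_count_eq_one hM hmem (by simp +decide) (at_ofQ_v A he c (h1 c) (h2 c) (h3 c))
      rw [(PClass.starSum_eq _).2.2.2.2.2.2.1, copyCount_spoke_one, copyCount_of_ne _ _ _ (by simp),
        copyCount_of_ne _ _ _ (by simp), connectCount]
      simp only [List.map_cons, List.map_nil, List.sum_cons, List.sum_nil] at this
      omega
    · rw [← sum_count_eq_one hM hmem ((PClass.nodup_star x).map fun p q h ↦ by simpa using h)
        (at_ofQ A he c hx hv), List.map_map, PClass.starSum]
      congr 1
      refine List.map_congr_left fun p hp ↦ copyCount_of_ne _ _ _ ?_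
      rintro rfl
      rcases PClass.mem_star.1 hp with rfl | rfl
      · exact hx rfl
      · exact hv rfl
  have key : ∀ c, connectCount M (w c) e + SClass.count M (.pet e c (.inner 1)) +
      SClass.count M (.pet e c (.inner 4)) = 1 := fun c ↦ by
    have := PClass.starSum_u_one (hne c) (by rw [hu]; fin_cases c <;> simp <;> omega)
    rw [copyCount_spoke_one] at this
    have := hu c
    omega
  refine ⟨fun c x ↦ ?_, ?_⟩
  · by_cases hx : x = u 1
    · have h := hu c
      have h' := key c
      rw [hx, (PClass.starSum_eq _).2.1, copyCount_spoke_one]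
      omega
    · exact hne c x hx
  · have h0 := key 0
    have h1 := key 1
    omega

/-- Disjoint edge sets contain together at most as many edges of a class as there are. -/
theorem sum_count_le {n : ℕ} {N : Fin n → Set (SEdge α β k)} (hk : 1 ≤ k)
    (hN : Pairwise fun i j ↦ Disjoint (N i) (N j)) (C : SClass α β) :
    ∑ i, SClass.count (N i) C ≤ C.mult k := by
  have h : (⋃ i, N i ∩ C.edges k).encard = ∑ i, (N i ∩ C.edges k).encard := by
    rw [Set.encard_iUnion_of_finite]
    · rw [finsum_eq_sum_of_fintype]
    · exact fun i j hij ↦ (hN hij).mono Set.inter_subset_left Set.inter_subset_left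
  have h' : (⋃ i, N i ∩ C.edges k).encard ≤ (C.edges k).encard :=
    Set.encard_le_encard (Set.iUnion_subset fun i ↦ Set.inter_subset_right)
  rw [h, ← (C.finite_edges k).cast_ncard_eq, C.ncard_edges hk] at h'
  simp only [← ((C.finite_edges k).inter_of_right _).cast_ncard_eq] at h'
  exact_mod_cast h'

/-- Of `4k - 2` pairwise disjoint perfect matchings, exactly `2k - 1` contain an edge between the
copy of `Q_k` at `e` and the copy of `T_k` at `w`. -/
theorem sum_connectCount {N : Fin (4 * k - 2) → Set (SEdge α β k)} (hk : 1 ≤ k)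
    (hN : ∀ i, (graphS G A k).IsPerfectMatching (N i))
    (hd : Pairwise fun i j ↦ Disjoint (N i) (N j)) {w : α} {e : β} (hwe : G.Inc e w) :
    ∑ i, connectCount (N i) w e = 2 * k - 1 := by
  choose w' h1 h2 h3 using A.exists_end hwe.edge_mem
  have hM := fun i ↦ starSum_copyCount (hN i) hwe.edge_mem h1 h2 h3
  have hle : ∀ c, ∑ i, connectCount (N i) (w' c) e ≤ 2 * k := by
    intro c
    have hb := fun b ↦ sum_count_le hk hd (.con (w' c) e b)
    have h0 := hb 0
    have h1 := hb 1
    simp only [SClass.mult] at h0 h1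
    simp only [connectCount, Finset.sum_add_distrib]
    omega
  have hne : ∀ c, ∑ i, connectCount (N i) (w' c) e ≠ 2 * k - 2 := by
    intro c
    have := PClass.ne_of_starSum_eq hk (f := fun p ↦ ∑ i, copyCount (N i) (w' c) e c p) ?_ ?_ ?_
    · simpa only [copyCount_spoke_one] using this
    · intro x
      rw [PClass.starSum_sum]
      simp [(hM _).1 c x]
    · simp only [← Finset.sum_add_distrib]
      exact Finset.even_sum _ fun i _ ↦ PClass.even_of_starSum_eq_one ((hM i).1 c)
    · intro p hp
      simp only [copyCount_of_ne _ _ _ hp]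
      exact sum_count_le hk hd (.pet e c p)
  have hsum : ∑ i, connectCount (N i) (w' 0) e + ∑ i, connectCount (N i) (w' 1) e = 4 * k - 2 := by
    rw [← Finset.sum_add_distrib]
    simp [(hM _).2]
  have hw : w = w' (A.side e w) := h3 _ _ hwe rfl
  rw [hw]
  have := hle 0
  have := hle 1
  have := hne 0
  have := hne 1
  rcases (show A.side e w = 0 ∨ A.side e w = 1 by omega) with h | h <;> rw [h] <;> omega

/-- The three edges of `G` at a vertex `w` would have to contribute `3 (2k - 1)` edges to the
matchings, while each of the `4k - 2` matchings contains an odd number of edges of the boundary of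
the copy of `T_k` at `w`. -/
theorem not_hasDisjointPerfectMatchings (A : Gluing G) (hk : 1 ≤ k) (hV : V(G).Nonempty) :
    ¬ (graphS G A k).HasDisjointPerfectMatchings (4 * k - 2) := by
  rintro ⟨N, hN, hd⟩
  obtain ⟨w, hw⟩ := hV
  obtain ⟨ε, h1, h2⟩ := A.exists_slotEdge hw
  have hε := fun j ↦ sum_connectCount hk hN hd (h1 j).1
  have key : ∀ i, connectCount (N i) w (ε 0) + connectCount (N i) w (ε 1) +
      connectCount (N i) w (ε 2) + 2 * (SClass.count (N i) (.tri w 0) +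
        SClass.count (N i) (.tri w 1) + SClass.count (N i) (.tri w 2)) = 3 := by
    intro i
    have hx : ∀ x : ZMod 3, x ≠ x - 1 := by decide
    have hx := fun x ↦ sum_count_eq_one (hN i) (a := .ofT w x)
      (mem_vertexSet_graphS.2 <| .inl ⟨w, hw, x, rfl⟩) (by simp [hx]) (at_ofT A hw h1 h2 x)
    have hx0 := hx 0
    have hx1 := hx 1
    have hx2 := hx 2
    rw [show (0 : ZMod 3) - 1 = 2 by decide] at hx0
    rw [show (1 : ZMod 3) - 1 = 0 by decide] at hx1
    rw [show (2 : ZMod 3) - 1 = 1 by decide] at hx2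
    simp only [List.map_cons, List.map_nil, List.sum_cons, List.sum_nil] at hx0 hx1 hx2
    simp only [connectCount]
    omega
  have hsum := Finset.sum_congr (rfl : (Finset.univ : Finset (Fin (4 * k - 2))) = _)
    fun i _ ↦ key i
  simp only [Finset.sum_add_distrib, ← Finset.mul_sum, hε] at hsum
  simp at hsum
  omega

end Matching

/-! ### Cuts of the Petersen graph -/

namespace PClass

/-- The edges of the Petersen graph other than `u_1 v_1`. -/
def others : List PClass :=
  [spoke 0, spoke 2, spoke 3, spoke 4, outer 0, outer 1, outer 2, outer 3, outer 4,
    inner 0, inner 1, inner 2, inner 3, inner 4]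

theorem nodup_others : others.Nodup := by
  simp +decide [others]

theorem ne_of_mem_others {p : PClass} (hp : p ∈ others) : p ≠ spoke 1 := by
  rintro rfl
  revert hp
  simp +decide [others]

/-- The total weight of the edges in a list whose ends have different colours. -/
def cutSum (m : PClass → ℕ) (g : PVertex → Bool) (L : List PClass) : ℕ :=
  (L.map fun p ↦ if g p.fst ≠ g p.snd then m p else 0).sum

/-- The coefficient of `k` in `mult k p`: the number of the matchings `M_0`, `M_1`, `M_3`, `M_4`
that contain the edge. -/
def slope : PClass → ℕ
  | spoke i => if i = 1 ∨ i = 3 ∨ i = 4 then 2 else 1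
  | outer i => if i = 2 ∨ i = 4 then 2 else if i = 3 then 0 else 1
  | inner i => if i = 0 then 2 else 1

theorem mult_eq {k : ℕ} (hk : 1 ≤ k) (p : PClass) : mult k p = mult 1 p + (k - 1) * slope p := by
  rcases p with i | i | i <;> simp only [mult, slope] <;> split_ifs <;> omega

/-- The colouring of the Petersen graph with given colours on the two `5`-cycles. -/
def coloring (a b : ZMod 5 → Bool) : PVertex → Bool
  | u i => a i
  | v i => b i

/-- Every cut of the Petersen graph has weight at least `4` with respect to the multiplicities of
`P_1` and with respect to `M_0 + M_1 + M_3 + M_4`. -/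
theorem four_le_cutSum (a b : ZMod 5 → Bool) : (∀ i, a i = a 0 ∧ b i = a 0) ∨
    4 ≤ cutSum (mult 1) (coloring a b) (spoke 1 :: others) ∧
    4 ≤ cutSum slope (coloring a b) (spoke 1 :: others) := by
  revert a b
  decide +kernel

/-- `P_k` is `4k`-edge-connected. -/
theorem four_mul_le_cutSum {k : ℕ} (hk : 1 ≤ k) {g : PVertex → Bool} (hg : ∃ x y, g x ≠ g y) :
    4 * k ≤ cutSum (mult k) g (spoke 1 :: others) := by
  have h1 : cutSum (mult k) g (spoke 1 :: others) = cutSum (mult 1) g (spoke 1 :: others) +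
      (k - 1) * cutSum slope g (spoke 1 :: others) := by
    rw [cutSum, cutSum, cutSum, ← List.sum_map_mul_left, ← List.sum_map_add]
    congr 1
    refine List.map_congr_left fun p _ ↦ ?_
    rw [mult_eq hk]
    split_ifs <;> simp
  have hg' : coloring (fun i ↦ g (u i)) (fun i ↦ g (v i)) = g := by
    funext x
    rcases x with i | i <;> rfl
  rcases four_le_cutSum (fun i ↦ g (u i)) (fun i ↦ g (v i)) with h | ⟨h2, h3⟩
  · exfalso
    have hall : ∀ x, g x = g (u 0) := by
      rintro (i | i)
      · exact (h i).1
      · exact (h i).2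
    obtain ⟨x, y, hxy⟩ := hg
    exact hxy ((hall x).trans (hall y).symm)
  · rw [hg'] at h2 h3
    rw [h1]
    have := Nat.mul_le_mul_left (k - 1) h3
    omega

/-- Cuts of `P_k` after the deletion of the class of `u_1 v_1`. -/
theorem le_cutSum_others {k : ℕ} (hk : 1 ≤ k) {g : PVertex → Bool} (hg : ∃ x y, g x ≠ g y) :
    2 * k ≤ cutSum (mult k) g others ∧ (g (u 1) = g (v 1) → 4 * k ≤ cutSum (mult k) g others) := by
  have h := four_mul_le_cutSum hk hg
  have h1 : cutSum (mult k) g (spoke 1 :: others) =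
      (if g (u 1) ≠ g (v 1) then 2 * k else 0) + cutSum (mult k) g others := rfl
  rw [h1] at h
  split_ifs at h with h2 <;> constructor <;> grind

end PClass

/-! ### Cuts of `S_k(G)` -/

namespace SClass

/-- The copy of `T_k` to which a class belongs, or the copy of `P_k` to which it belongs, given by
an edge of `G` and the number of the copy in `Q_k`. The connecting edges at `w` are counted to the
copy of `T_k` at `w`. -/
def home : SClass α β → α ⊕ β × Fin 2
  | tri w _ => .inl w
  | con w _ _ => .inl w
  | pet e c _ => .inr (e, c)

/-- The class `C` is present in `S_k(G)` and its ends have different colours under `χ`. -/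
def Cut {G : Graph α β} (A : Gluing G) (χ : SVertex α β → Bool) (C : SClass α β) : Prop :=
  C.IsIn G ∧ χ (C.fst A) ≠ χ (C.snd A)

end SClass

/-- The classes that belong to the part `h` of `S_k(G)` contribute at least `r` edges to the cut
between the two colours. -/
def CutAt {G : Graph α β} (A : Gluing G) (k : ℕ) (χ : SVertex α β → Bool) (h : α ⊕ β × Fin 2)
    (r : ℕ) : Prop :=
  ∃ L : List (SClass α β), L.Nodup ∧ (∀ C ∈ L, C.Cut A χ ∧ C.home = h) ∧
    r ≤ (L.map (SClass.mult k)).sum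

theorem sum_map_filter {ι : Type*} (L : List ι) (p : ι → Bool) (f : ι → ℕ) :
    ((L.filter p).map f).sum = (L.map fun i ↦ if p i then f i else 0).sum := by
  induction L with
  | nil => rfl
  | cons i L ih => by_cases hi : p i <;> simp [hi, ih]

section Cut

variable {G : Graph α β} {A : Gluing G} {k : ℕ} {χ : SVertex α β → Bool}

theorem cutAt_inr (hk : 1 ≤ k) {e : β} (he : e ∈ E(G)) (c : Fin 2)
    (h : ∃ x y, χ (.ofQ e (identifyU (c, x))) ≠ χ (.ofQ e (identifyU (c, y)))) :
    CutAt A k χ (.inr (e, c)) (2 * k) ∧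
      (χ (.ofQ e (identifyU (c, u 1))) = χ (.ofQ e (identifyU (c, v 1))) →
        CutAt A k χ (.inr (e, c)) (4 * k)) := by
  set g : PVertex → Bool := fun x ↦ χ (.ofQ e (identifyU (c, x))) with hg
  have key : ∀ r, r ≤ PClass.cutSum (PClass.mult k) g PClass.others →
      CutAt A k χ (.inr (e, c)) r := by
    intro r hr
    refine ⟨(PClass.others.filter fun p ↦ g p.fst ≠ g p.snd).map (.pet e c),
      (PClass.nodup_others.filter _).map fun p q h ↦ by simpa using h, ?_, ?_⟩
    · intro C hC
      obtain ⟨p, hp, rfl⟩ := List.mem_map.1 hC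
      rw [List.mem_filter] at hp
      exact ⟨⟨⟨he, PClass.ne_of_mem_others hp.1⟩, of_decide_eq_true hp.2⟩, rfl⟩
    · refine hr.trans_eq ?_
      rw [List.map_map, sum_map_filter]
      simp only [decide_eq_true_eq]
      rfl
  have := PClass.le_cutSum_others hk (g := g) h
  exact ⟨key _ this.1, fun h' ↦ key _ (this.2 h')⟩

/-- The cut edges in the copy of `T_k` at `w` and among its connecting edges come in classes of size
`k`; `r` of these nine classes give `r * k` cut edges. -/
theorem cutAt_inl {w : α} (hw : w ∈ V(G)) {ε : ZMod 3 → β}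
    (hε : ∀ i, G.Inc (ε i) w ∧ A.slot w (ε i) = i) {r : ℕ}
    (hr : r ≤ ([0, 1, 2].map fun i : ZMod 3 ↦
      (if χ (.ofT w i) ≠ χ (.ofT w (i + 1)) then 1 else 0) +
      (if χ (.ofT w i) ≠ χ (.ofQ (ε i) (A.side (ε i) w, v 1)) then 1 else 0) +
      (if χ (.ofT w (i + 1)) ≠ χ (.ofQ (ε i) (A.side (ε i) w, v 1)) then 1 else 0)).sum) :
    CutAt A k χ (.inl w) (r * k) := by
  have hinj : ∀ i j, ε i = ε j → i = j := fun i j h ↦ (hε i).2.symm.trans (h ▸ (hε j).2)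
  have h01 : ε 0 ≠ ε 1 := fun h ↦ absurd (hinj 0 1 h) (by decide)
  have h02 : ε 0 ≠ ε 2 := fun h ↦ absurd (hinj 0 2 h) (by decide)
  have h12 : ε 1 ≠ ε 2 := fun h ↦ absurd (hinj 1 2 h) (by decide)
  let L : List (SClass α β) := [.tri w 0, .con w (ε 0) 0, .con w (ε 0) 1, .tri w 1, .con w (ε 1) 0,
    .con w (ε 1) 1, .tri w 2, .con w (ε 2) 0, .con w (ε 2) 1]
  have hL : L.Nodup := by
    simp +decide [L, h01, h02, h12]
  refine ⟨L.filter fun C ↦ χ (C.fst A) != χ (C.snd A), hL.filter _, ?_, ?_⟩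
  · intro C hC
    rw [List.mem_filter] at hC
    refine ⟨⟨?_, by simpa using hC.2⟩, ?_⟩
    · have := hC.1
      simp only [L, List.mem_cons, List.not_mem_nil, or_false] at this
      rcases this with rfl | rfl | rfl | rfl | rfl | rfl | rfl | rfl | rfl <;>
        first | exact hw | exact (hε _).1
    · have := hC.1
      simp only [L, List.mem_cons, List.not_mem_nil, or_false] at this
      rcases this with rfl | rfl | rfl | rfl | rfl | rfl | rfl | rfl | rfl <;> rfl
  · refine (Nat.mul_le_mul_right k hr).trans_eq ?_
    rw [sum_map_filter]
    simp only [L, List.map_cons, List.map_nil, List.sum_cons, List.sum_nil, SClass.fst, SClass.snd,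
      SClass.mult, (hε _).2, add_mul, ite_mul, one_mul, zero_mul, bne_iff_ne, add_zero]
    simp [add_assoc]

theorem cutAt_inl_two {w : α} (hw : w ∈ V(G)) {e e' : β} (he : G.Inc e w) (he' : G.Inc e' w)
    (h : χ (.ofQ e (A.side e w, v 1)) ≠ χ (.ofQ e' (A.side e' w, v 1))) :
    CutAt A k χ (.inl w) (2 * k) := by
  obtain ⟨ε, h1, h2⟩ := A.exists_slotEdge hw
  refine cutAt_inl hw h1 ?_
  have key : ∀ (x q : ZMod 3 → Bool), (∃ i j, q i ≠ q j) → 2 ≤ ([0, 1, 2].map fun i : ZMod 3 ↦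
      (if x i ≠ x (i + 1) then 1 else 0) + (if x i ≠ q i then 1 else 0) +
      (if x (i + 1) ≠ q i then 1 else 0)).sum := by decide
  refine key (fun i ↦ χ (.ofT w i)) (fun i ↦ χ (.ofQ (ε i) (A.side (ε i) w, v 1)))
    ⟨A.slot w e, A.slot w e', ?_⟩
  simpa only [← h2 e he, ← h2 e' he'] using h

theorem cutAt_inl_four {w : α} (hw : w ∈ V(G))
    (h : ∀ e e', G.Inc e w → G.Inc e' w →
      χ (.ofQ e (A.side e w, v 1)) = χ (.ofQ e' (A.side e' w, v 1)))
    {e : β} (he : G.Inc e w) {x : ZMod 3}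
    (hx : χ (.ofT w x) ≠ χ (.ofQ e (A.side e w, v 1))) :
    CutAt A k χ (.inl w) (4 * k) := by
  obtain ⟨ε, h1, h2⟩ := A.exists_slotEdge hw
  refine cutAt_inl hw h1 ?_
  have key : ∀ (y : ZMod 3 → Bool) (q : Bool), (∃ i, y i ≠ q) → 4 ≤ ([0, 1, 2].map fun i : ZMod 3 ↦
      (if y i ≠ y (i + 1) then 1 else 0) + (if y i ≠ q then 1 else 0) +
      (if y (i + 1) ≠ q then 1 else 0)).sum := by decide
  have := key (fun i ↦ χ (.ofT w i)) _ ⟨x, hx⟩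
  simpa only [h _ _ (h1 _).1 he] using this

end Cut

/-! ### Edge-connectivity of `S_k(G)` -/

section Cut

variable {G : Graph α β} {A : Gluing G} {k : ℕ} {χ : SVertex α β → Bool}

theorem sum_mult_le_ncard_edgeBoundary (hk : 1 ≤ k) {S : Set (SVertex α β)}
    (hχ : ∀ a, χ a = true ↔ a ∈ S) (hfin : ((graphS G A k).edgeBoundary S).Finite)
    {L : List (SClass α β)} (hL : L.Nodup) (hcut : ∀ C ∈ L, C.Cut A χ) :
    (L.map (SClass.mult k)).sum ≤ ((graphS G A k).edgeBoundary S).ncard := by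
  have h := SClass.ncard_inter_biUnion (k := k) Set.univ hL
  rw [List.map_congr_left fun C _ ↦ SClass.count_univ hk C, Set.univ_inter] at h
  rw [← h]
  refine Set.ncard_le_ncard (fun f hf ↦ ?_) hfin
  obtain ⟨C, hC, hfC⟩ := Set.mem_iUnion₂.1 hf
  obtain ⟨h1, h2⟩ := hcut C hC
  have hl : (graphS G A k).IsLink f (C.fst A) (C.snd A) := isLink_graphS_iff.2 ⟨C, h1, hfC, rfl⟩
  by_cases hS : C.fst A ∈ S
  · exact ⟨_, hS, _, fun h' ↦ h2 (((hχ _).2 hS).trans ((hχ _).2 h').symm), hl⟩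
  · refine ⟨_, ?_, _, hS, hl.symm⟩
    by_contra h'
    rw [← hχ, Bool.not_eq_true] at hS h'
    exact h2 (hS.trans h'.symm)

/-- Contributions of different parts of `S_k(G)` to a cut add up. -/
theorem CutAt.eq (hk : 1 ≤ k) {S : Set (SVertex α β)} (hχ : ∀ a, χ a = true ↔ a ∈ S)
    (hfin : ((graphS G A k).edgeBoundary S).Finite)
    (hlt : ((graphS G A k).edgeBoundary S).ncard < 4 * k) {h h' : α ⊕ β × Fin 2}
    (H : CutAt A k χ h (2 * k)) (H' : CutAt A k χ h' (2 * k)) : h = h' := by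
  by_contra hne
  obtain ⟨L, hL, hcut, hsum⟩ := H
  obtain ⟨L', hL', hcut', hsum'⟩ := H'
  have hdisj : L.Disjoint L' := fun C hC hC' ↦ hne ((hcut C hC).2.symm.trans (hcut' C hC').2)
  have := sum_mult_le_ncard_edgeBoundary hk hχ hfin (List.Nodup.append hL hL' hdisj) fun C hC ↦
    (List.mem_append.1 hC).elim (fun h ↦ (hcut C h).1) (fun h ↦ (hcut' C h).1)
  rw [List.map_append, List.sum_append] at this
  omega

theorem CutAt.false (hk : 1 ≤ k) {S : Set (SVertex α β)} (hχ : ∀ a, χ a = true ↔ a ∈ S)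
    (hfin : ((graphS G A k).edgeBoundary S).Finite)
    (hlt : ((graphS G A k).edgeBoundary S).ncard < 4 * k) {h : α ⊕ β × Fin 2}
    (H : CutAt A k χ h (4 * k)) : False := by
  obtain ⟨L, hL, hcut, hsum⟩ := H
  have := sum_mult_le_ncard_edgeBoundary hk hχ hfin hL fun C hC ↦ (hcut C hC).1
  omega

end Cut

/-- The colours of the pairs of an edge and an end cannot be such that the colour at each end of an
edge is the same and that exactly one vertex sees both colours: one of the three edges at that
vertex would have to be a bridge. -/
theorem not_exists_unique_mixed {G : Graph α β} (hcubic : G.IsCubic) (hb : G.IsBridgeless)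
    (φ : α → β → Bool) (hedge : ∀ e x y, G.IsLink e x y → φ x e = φ y e) {w : α} (hw : w ∈ V(G))
    (hne : ∃ e e', G.Inc e w ∧ G.Inc e' w ∧ φ w e ≠ φ w e')
    (hconst : ∀ z ≠ w, ∀ e e', G.Inc e z → G.Inc e' z → φ z e = φ z e') : False := by
  -- One of the three edges at `w` has a colour different from that of the other two.
  obtain ⟨e, he, hodd⟩ : ∃ e, G.Inc e w ∧ ∀ f, G.Inc f w → f ≠ e → φ w f ≠ φ w e := by
    obtain ⟨a, b, c, hab, hac, hbc, h⟩ := Set.encard_eq_three.1 (hcubic.regular w hw)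
    have hinc : ∀ f, G.Inc f w ↔ f = a ∨ f = b ∨ f = c := fun f ↦ by
      rw [← Graph.mem_incidenceSet, h]
      simp
    simp only [hinc] at hne ⊢
    by_cases h1 : φ w a = φ w b
    · exact ⟨c, by grind⟩
    · by_cases h2 : φ w a = φ w c
      · exact ⟨b, by grind⟩
      · exact ⟨a, by grind⟩
  obtain ⟨w', hl⟩ := he
  have hww' : w' ≠ w := by
    rintro rfl
    exact hcubic.loopless.not_isLoopAt e _ hl
  have key : ∀ z, (G.deleteEdges {e}).Reaches w' z →
      z ≠ w ∧ ∀ f, G.Inc f z → φ z f = φ w e := by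
    intro z hz
    induction hz with
    | refl =>
      exact ⟨hww', fun f hf ↦
        (hconst w' hww' f e hf hl.inc_right).trans (hedge e w w' hl).symm⟩
    | @tail z z' _ hzz' ih =>
      obtain ⟨f, hf⟩ := hzz'
      rw [Graph.deleteEdges_isLink] at hf
      obtain ⟨hf, hfe⟩ := hf
      have hf' : φ z' f = φ w e := (hedge f z z' hf).symm.trans (ih.2 f hf.inc_left)
      have hz' : z' ≠ w := by
        rintro rfl
        exact hodd f hf.inc_right (by simpa using hfe) hf'
      exact ⟨hz', fun g hg ↦ (hconst z' hz' g f hg hf.inc_right).trans hf'⟩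
  exact (key w (hb e w' w hl.symm)).1 rfl

/-- An edge whose ends have different colours, while all other edges and all vertices have only one
colour, is a bridge. -/
theorem not_exists_unique_change {G : Graph α β} (hb : G.IsBridgeless)
    (φ : α → β → Bool) (hconst : ∀ z, ∀ e e', G.Inc e z → G.Inc e' z → φ z e = φ z e')
    {e : β} {x y : α} (hl : G.IsLink e x y) (hne : φ x e ≠ φ y e)
    (hedge : ∀ f ≠ e, ∀ x y, G.IsLink f x y → φ x f = φ y f) : False := by
  have key : ∀ z, (G.deleteEdges {e}).Reaches x z → ∀ f, G.Inc f z → φ z f = φ x e := by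
    intro z hz
    induction hz with
    | refl => exact fun f hf ↦ hconst x f e hf hl.inc_left
    | @tail z z' _ hzz' ih =>
      obtain ⟨f, hf⟩ := hzz'
      rw [Graph.deleteEdges_isLink] at hf
      obtain ⟨hf, hfe⟩ := hf
      exact fun g hg ↦ (hconst z' g f hg hf.inc_right).trans
        ((hedge f (by simpa using hfe) z z' hf).symm.trans (ih f hf.inc_left))
  exact hne (key y (hb e x y hl) e hl.inc_right).symm

/-- Every cut of `S_k(G)` has at least `4k` edges. -/
theorem four_mul_le_ncard_edgeBoundary {G : Graph α β} (hcubic : G.IsCubic) (hconn : G.IsConnected)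
    (hb : G.IsBridgeless) (A : Gluing G) {k : ℕ} (hk : 1 ≤ k) {S : Set (SVertex α β)}
    {a b : SVertex α β} (ha : a ∈ V(graphS G A k)) (hb' : b ∈ V(graphS G A k)) (haS : a ∈ S)
    (hbS : b ∉ S) : 4 * k ≤ ((graphS G A k).edgeBoundary S).ncard := by
  classical
  have hfin : ((graphS G A k).edgeBoundary S).Finite :=
    (isFiniteLoopless_graphS hcubic.toIsFiniteLoopless A hk).finite_edgeSet.subset
      fun f ⟨_, _, _, _, h⟩ ↦ h.edge_mem
  by_contra! hlt
  let χ : SVertex α β → Bool := fun a ↦ decide (a ∈ S)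
  have hχ : ∀ a, χ a = true ↔ a ∈ S := fun a ↦ decide_eq_true_iff
  have huniq : ∀ {h h' : α ⊕ β × Fin 2}, CutAt A k χ h (2 * k) → CutAt A k χ h' (2 * k) → h = h' :=
    fun H H' ↦ CutAt.eq hk hχ hfin hlt H H'
  have hfalse : ∀ {h : α ⊕ β × Fin 2}, ¬ CutAt A k χ h (4 * k) :=
    fun H ↦ CutAt.false hk hχ hfin hlt H
  -- The colour of the copy of `v_1` that represents the end `w` of the edge `e`.
  let φ : α → β → Bool := fun w e ↦ χ (.ofQ e (A.side e w, v 1))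
  -- If both copies of `P_k` in the copy of `Q_k` at `e` are monochromatic, then so is the
  -- copy of `Q_k`, because they share `u_1`.
  have hQ : ∀ e, (∀ c x y, χ (.ofQ e (identifyU (c, x))) = χ (.ofQ e (identifyU (c, y)))) →
      ∀ c x d y, χ (.ofQ e (identifyU (c, x))) = χ (.ofQ e (identifyU (d, y))) := fun e h c x d y ↦
    (h c x (u 1)).trans (h d (u 1) y)
  have hv : ∀ c, identifyU (c, v 1) = (c, v 1) := fun c ↦ if_neg (by simp)
  have hφe : ∀ e x y, G.IsLink e x y →
      (∀ c x y, χ (.ofQ e (identifyU (c, x))) = χ (.ofQ e (identifyU (c, y)))) →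
      φ x e = φ y e := by
    intro e x y _ h
    have := hQ e h (A.side e x) (v 1) (A.side e y) (v 1)
    simpa only [hv] using this
  by_cases hmix : ∃ w ∈ V(G), ∃ e e', G.Inc e w ∧ G.Inc e' w ∧ φ w e ≠ φ w e'
  · obtain ⟨w, hw, e, e', he, he', hne⟩ := hmix
    have hC : CutAt A k χ (.inl w) (2 * k) := cutAt_inl_two hw he he' hne
    refine not_exists_unique_mixed hcubic hb φ (fun f x y hf ↦ hφe f x y hf ?_) hw
      ⟨e, e', he, he', hne⟩ ?_
    · by_contra! h
      obtain ⟨c, p, q, hpq⟩ := h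
      have := huniq hC (cutAt_inr hk hf.edge_mem c ⟨p, q, hpq⟩).1
      simp at this
    · intro z hz f f' hf hf'
      by_contra hne'
      exact hz (Sum.inl_injective (huniq (cutAt_inl_two hf.vertex_mem hf hf' hne') hC))
  have hconst : ∀ z, ∀ e e', G.Inc e z → G.Inc e' z → φ z e = φ z e' := by
    intro z e e' he he'
    by_contra hne
    exact hmix ⟨z, he.vertex_mem, e, e', he, he', hne⟩
  by_cases hP : ∃ e ∈ E(G), ∃ c x y,
      χ (.ofQ e (identifyU (c, x))) ≠ χ (.ofQ e (identifyU (c, y)))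
  · obtain ⟨e, he, c, p, q, hpq⟩ := hP
    obtain ⟨hC, hC'⟩ := cutAt_inr (A := A) hk he c ⟨p, q, hpq⟩
    have hother : ∀ f ∈ E(G), ∀ d, (f, d) ≠ (e, c) → ∀ x y,
        χ (.ofQ f (identifyU (d, x))) = χ (.ofQ f (identifyU (d, y))) := by
      intro f hf d hd x y
      by_contra hne
      exact hd (Sum.inr_injective (huniq (cutAt_inr hk hf d ⟨x, y, hne⟩).1 hC))
    -- The two copies of `v_1` have different colours, since in exactly one of the two copies
    -- of `P_k` the colours of `u_1` and `v_1` differ.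
    have hvv : ∀ d ≠ c, χ (.ofQ e (c, v 1)) ≠ χ (.ofQ e (d, v 1)) := by
      intro d hd h
      have h1 := hother e he d (by simpa using hd) (u 1) (v 1)
      refine hfalse (hC' ?_)
      rw [hv] at h1 ⊢
      exact h1.trans h.symm
    obtain ⟨x, y, hl⟩ := G.exists_isLink_of_mem_edgeSet he
    have hside := A.side_ne e x y hl
    refine not_exists_unique_change hb φ hconst hl ?_ fun f hf x y hl' ↦ hφe f x y hl' fun d ↦
      hother f hl'.edge_mem d (by simp [hf])
    by_cases hx : A.side e x = c
    · have := hvv (A.side e y) (by rw [← hx]; exact hside.symm)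
      rwa [← hx] at this
    · have hy : A.side e y = c := by omega
      have := hvv (A.side e x) hx
      rw [← hy] at this
      exact this.symm
  · push Not at hP
    -- Now everything belonging to a vertex of `G` or to an edge at this vertex has the same colour.
    have hT : ∀ e w x, G.Inc e w → χ (.ofT w x) = φ w e := by
      intro e w x he
      by_contra hne
      exact hfalse (cutAt_inl_four he.vertex_mem (hconst w) he hne)
    have hinc : ∀ w ∈ V(G), ∃ e, G.Inc e w := fun w hw ↦
      ((A.bijOn_slot w hw).surjOn (Set.mem_univ 0)).imp fun e h ↦ h.1
    have hreach : ∀ x y, G.Reaches x y → χ (.ofT x 0) = χ (.ofT y 0) := by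
      intro x y h
      induction h with
      | refl => rfl
      | tail _ hzz' ih =>
        obtain ⟨f, hf⟩ := hzz'
        rw [ih, hT f _ 0 hf.inc_left, hT f _ 0 hf.inc_right]
        exact hφe f _ _ hf (hP f hf.edge_mem)
    have hvert : ∀ a ∈ V(graphS G A k), ∃ w ∈ V(G), χ a = χ (.ofT w 0) := by
      intro a ha
      rcases mem_vertexSet_graphS.1 ha with ⟨w, hw, x, rfl⟩ | ⟨e, he, q, ⟨q, -, rfl⟩, rfl⟩
      · obtain ⟨e, he⟩ := hinc w hw
        exact ⟨w, hw, (hT e w x he).trans (hT e w 0 he).symm⟩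
      · obtain ⟨x, y, hl⟩ := G.exists_isLink_of_mem_edgeSet he
        refine ⟨x, hl.left_mem, ?_⟩
        rw [hT e x 0 hl.inc_left]
        have := hQ e (hP e he) q.1 q.2 (A.side e x) (v 1)
        rwa [hv] at this
    obtain ⟨w, hw, h1⟩ := hvert a ha
    obtain ⟨w', hw', h2⟩ := hvert b hb'
    have := h1.trans ((hreach w w' (hconn.2 w hw w' hw')).trans h2.symm)
    rw [(hχ a).2 haS] at this
    exact hbS ((hχ b).1 this.symm)

end PetersenGluing

/-- A graph with at least two vertices all of whose cuts have at least `t` edges is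
`t`-edge-connected. -/
theorem Graph.isEdgeConnected_of_le_encard_edgeBoundary {α β : Type*} {H : Graph α β} {t : ℕ}
    (hV : V(H).Nontrivial) (h : ∀ S : Set α, ∀ a ∈ V(H), ∀ b ∈ V(H), a ∈ S → b ∉ S →
      (t : ℕ∞) ≤ (H.edgeBoundary S).encard) : H.IsEdgeConnected t := by
  refine ⟨hV, fun F _ hlt ↦ ⟨hV.nonempty, fun x hx y hy ↦ ?_⟩⟩
  by_contra hxy
  refine (h {z | (H.deleteEdges F).Reaches x z} x hx y hy Relation.ReflTransGen.refl hxy).not_gt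
    ((Set.encard_le_encard ?_).trans_lt hlt)
  rintro f ⟨z, hz, z', hz', hf⟩
  by_contra hfF
  exact hz' (Relation.ReflTransGen.tail hz ⟨f, by
    rw [Graph.deleteEdges_isLink]
    exact ⟨hf, hfF⟩⟩)

theorem mainTheorem2 {α β : Type*} (G : Graph α β) (hcubic : G.IsCubic) (hconn : G.IsConnected)
    (hbridgeless : G.IsBridgeless) (heven : Even E(G).ncard) (k : ℕ) (hk : 1 ≤ k)
    (A : PetersenGluing.Gluing G) :
    (PetersenGluing.graphS G A k).IsEdgeConnected (4 * k) ∧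
      (PetersenGluing.graphS G A k).IsRGraph (4 * k) ∧
      ¬ (PetersenGluing.graphS G A k).HasDisjointPerfectMatchings (4 * k - 2) := by
  have hS := PetersenGluing.isFiniteLoopless_graphS hcubic.toIsFiniteLoopless A hk
  have hcut : ∀ S : Set (PetersenGluing.SVertex α β), ∀ a ∈ V(PetersenGluing.graphS G A k),
      ∀ b ∈ V(PetersenGluing.graphS G A k), a ∈ S → b ∉ S →
      ((4 * k : ℕ) : ℕ∞) ≤ ((PetersenGluing.graphS G A k).edgeBoundary S).encard := by
    intro S a ha b hb haS hbS
    rw [← (hS.finite_edgeSet.subset (by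
      rintro f ⟨_, _, _, _, h⟩
      exact h.edge_mem)).cast_ncard_eq]
    exact_mod_cast
      PetersenGluing.four_mul_le_ncard_edgeBoundary hcubic hconn hbridgeless A hk ha hb haS hbS
  refine ⟨Graph.isEdgeConnected_of_le_encard_edgeBoundary ?_ hcut,
    ⟨hS, PetersenGluing.isRegular_graphS A hk, fun S hSV hodd ↦ ?_⟩,
    PetersenGluing.not_hasDisjointPerfectMatchings A hk hconn.1⟩
  · obtain ⟨w, hw⟩ := hconn.1
    exact ⟨.ofT w 0, .inl ⟨w, hw, 0, trivial, rfl⟩, .ofT w 1, .inl ⟨w, hw, 1, trivial, rfl⟩,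
      by simp⟩
  · -- The order of `S_k(G)` is even, so that an odd set of vertices is neither empty
    -- nor the whole vertex set.
    have hVeven := PetersenGluing.even_ncard_vertexSet_graphS hcubic.toIsFiniteLoopless A heven k
    obtain ⟨a, ha⟩ := Set.nonempty_of_ncard_ne_zero (s := S) (by rintro h; simp [h] at hodd)
    obtain ⟨b, hb, hbS⟩ := Set.exists_of_ssubset (hSV.ssubset_of_ne (by
      rintro rfl
      exact (Nat.not_even_iff_odd.2 hodd) hVeven))
    exact hcut S a (hSV ha) b hb ha hbS
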